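/- **Setting.** Let $\Pi$ be a finite subset of a countably infinite set of node label symbols. A $\Pi$-labeled graph is a finite directed graph $G=(V,E,\lambda)$ (self-loops allowed) with $\lambda\colon V\to\mathcal P(\Pi)$. A pointed graph classifier over $\Pi$ maps each pointed $\Pi$-labeled graph $(G,v)$ to an element of a set $T$ and is invariant under isomorphism. Two sets of pointed graph classifiers *have the same expressive power* if every member of either set equals, as a function on all pointed $\Pi$-labeled graphs, some member of the other. **Runs.** A run-skeleton over $V$ w.r.t. $S$ is a sequence $(r_i)_{i\in\mathbb N}$ of partial functions $V\rightharpoonup S$ with $\mathrm{dom}(r_{i+1})\subseteq\mathrm{dom}(r_i)$. A pa-run (pointed attention run) w.r.t. $(S,\mathcal A)$ is a tuple $(r,f,\alpha,v)$ where, for some domain $V$, $r$ is a run-skeleton over $V$ w.r.t. $S$, $f\colon S\to\mathcal A$ assigns colors to labels, $\alpha$ is a run-skeleton over $V$ w.r.t. $\{0,1\}$ and $v\in V$. Round $i$ is an attention round at $u\in V$ if $\alpha_i(u)=1$. The processed run of $(r,f,\alpha,v)$ is $(r',f,v)$, where $r'_k(u)=r_i(u)$ if $i$ is the $(k+1)$th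 attention round at $u$, and $r'_k(u)$ is undefined if there is no such round. Two (processed) pa-runs with the same $f$ are domain-isomorphic if a bijection between their domains preserves the point, $r$ and (for pa-runs) $\alpha$. A pa-run classification w.r.t. $(S,\mathcal A)$ is a function from pa-runs w.r.t. $(S,\mathcal A)$ to $T$ that is constant on domain-isomorphic pa-runs; it is *attention-invariant* if it takes the same value on any two pa-runs whose processed runs are domain-isomorphic. A color similarity $\sim_p$ between color sets $\mathcal B$ and $\mathcal B'$ is given by a partition $\mathfrak P$ of $\mathcal B$, a partition $\mathfrak P'$ of $\mathcal B'$ and a bijection $p\colon\mathfrak P\to\mathfrak P'$; for labels $s,s'$ colored by $f,f'$ one puts $s\sim_p s'$ if $f(s)\in P$ and $f'(s')\in p(P)$ for some $P\in\mathfrak P$. Pa-runs $(r,f,\alpha,v)$ and $(r',f',\alpha',v')$ are run-similar w.r.t. $\sim_p$ if there is a bijection $g$ of their domains with $g(v)=v'$ such that for all $i,u$ the labels $r_i(u)$, $r'_i(g(u))$ are both undefined or both defined with $r_i(u)\sim_p r'_i(g(u))$, and $\alpha_i(u)=\alpha'_i(g(u))$. Classifications $C$ w.r.t. $(S,\mathcal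 B)$ and $C'$ w.r.t. $(S',\mathcal B')$ are equivalent w.r.t. $\sim_p$ if $C(\rho)=C'(\rho')$ whenever $\rho,\rho'$ are run-similar w.r.t. $\sim_p$. An attention function assigns to each $\Pi$-labeled graph $G$ a run-skeleton over its nodes w.r.t. $\{0,1\}$, invariantly under isomorphism. An attention run-generator over $\Pi$ w.r.t. $(S,\mathcal A)$ consists of an assignment $f\colon S\to\mathcal A$, an attention function and an isomorphism-invariant map assigning to each graph $G$ a run-skeleton over its nodes w.r.t. $S$; so it yields a pa-run in each pointed graph. A pa-run classifier for a class $\mathcal R$ of attention run-generators consists of one pa-run classification w.r.t. $(S,\mathcal A)$ for each label set $S$ in use in $\mathcal R$; it turns each member of $\mathcal R$ into a pointed graph classifier, and $(\mathcal R,C)$ denotes the resulting set. It is attention-invariant if all of its classifications are, and two classifiers are equivalent w.r.t. $\sim_p$ if each classification of one is equivalent w.r.t. $\sim_p$ to each classification of the other. **Models.** Each of the following is equipped with an arbitrary attention function and an arbitrary assignment $f\colon S\to\mathcal A$ of colors to its configuration labels ("generalized", "+A"; "+AG" if also equipped with globality). * *Generalized $\mathrm{GMSC+AG}$.* Schemata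 are built from $\top$, symbols $q\in\Pi$, head predicates $X$ from a finite set $\mathcal T$, and $\neg,\wedge,\Diamond_{\ge k},\langle e\rangle_{\ge k}$ ($k\in\mathbb N$), where $\Diamond_{\ge k}\varphi$ (resp. $\langle e\rangle_{\ge k}\varphi$) holds at a node if $\varphi$ holds at at least $k$ of its out-neighbours (resp. of all nodes of the graph). A program gives for each $X\in\mathcal T$ a terminal body without head predicates, which is the iteration formula $X^0$, and an iteration body $\psi_X$; $X^{n+1}$ is $\psi_X$ with each $Y\in\mathcal T$ replaced by $Y^n$. In round $i$ a node $u$ has the label $\{X\in\mathcal T: G,u\models X^i\}\in S=\mathcal P(\mathcal T)$. $\mathrm{GMSC+A}$ is the same without $\langle e\rangle_{\ge k}$. * *Generalized $\mathrm{GNN[F]+AG}$.* A floating-point system $F$ is given by $p\ge1$, $n\ge0$, $\beta\ge2$: its elements are the rationals $\pm0.d_1\cdots d_p\times\beta^e$ (base-$\beta$ digits, $-n\le e\le n$), and $+$ and $\cdot$ are the exact operations followed by rounding to the closest element (ties go to the even least significant digit; if this does not decide, to the larger magnitude). States are vectors in $S=F^d$, $d\ge1$, with $F$ and $d$ arbitrary.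 A node $v$ starts in $\pi(\lambda(v))$ and is updated by $$x_v^{t+1}=\mathrm{COM}\bigl(x^t_v,\ \mathrm{AGG}(\{\{x^t_u: (v,u)\in E\}\}),\ \mathrm{READ}(\{\{x^t_u: u\in V\}\})\bigr),$$ where $\pi$ and $\mathrm{COM}$ are arbitrary and $\mathrm{AGG},\mathrm{READ}$ are functions from multisets over $F^d$ to $F^d$ that, for some $k$, count multiplicities only up to $k$. In round $t$ the label of $v$ is $x_v^t$. For $\mathrm{GNN[F]+A}$, omit $\mathrm{READ}$. * *Generalized R-simple aggregate-combine $\mathrm{GNN[F]+AG}$.* The $\mathrm{GNN[F]+AG}$s in which $\mathrm{AGG}$ and $\mathrm{READ}$ are the componentwise sum of floats in increasing order and $\mathrm{COM}(x,y,z)=\mathrm{ReLU}^*(x\cdot C+y\cdot A+z\cdot R+b)$ in float arithmetic, with $C,A,R\in F^{d\times d}$, $b\in F^d$ and $\mathrm{ReLU}^*(x)=\min(\max(0,x),1)$ componentwise. For $\mathrm{GNN[F]+A}$, omit $\mathrm{READ}$ and $z\cdot R$. **Theorem.** Let $\Pi$ be as above and let $\sim_p$ be any color similarity between sets of colors $\mathcal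 B$ and $\mathcal B'$. Let $\mathcal R$ and $\mathcal R'$ be two of the following three classes over $\Pi$, with colors $\mathcal B$ and $\mathcal B'$ respectively: generalized $\mathrm{GNN[F]+AG}$s, generalized R-simple aggregate-combine $\mathrm{GNN[F]+AG}$s, generalized $\mathrm{GMSC+AG}$. If $C$ and $C'$ are attention-invariant pa-run classifiers for $\mathcal R$ and $\mathcal R'$ that are equivalent w.r.t. $\sim_p$, then $(\mathcal R,C)$ and $(\mathcal R',C')$ have the same expressive power. The same holds without globality, i.e. for generalized $\mathrm{GNN[F]+A}$s, generalized R-simple aggregate-combine $\mathrm{GNN[F]+A}$s and generalized $\mathrm{GMSC+A}$. -/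

import Mathlib

namespace RecGNN

/-! ### Labeled graphs -/

/-- The countably infinite set of node label symbols. -/
abbrev LAB := ℕ

/-- Finite directed graphs (self-loops allowed) whose nodes carry sets of symbols from the finite
set `L` of node label symbols. -/
structure LGraph (L : Finset LAB) where
  V : Type
  finite : Finite V
  E : V → V → Prop
  lab : V → Set L

attribute [instance] LGraph.finite

/-- Isomorphisms of labeled graphs. -/
structure LGraph.Iso {L : Finset LAB} (G H : LGraph L) where
  toEquiv : G.V ≃ H.V
  edge : ∀ u v, G.E u v ↔ H.E (toEquiv u) (toEquiv v)
  lab : ∀ u, G.lab u = H.lab (toEquiv u)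

/-- The multiset `{{ x u | (v, u) ∈ E }}`. -/
noncomputable def LGraph.outMultiset {L : Finset LAB} (G : LGraph L) {Q : Type} (x : G.V → Q)
    (v : G.V) : Multiset Q :=
  (Set.toFinite {u | G.E v u}).toFinset.val.map x

/-- The multiset `{{ x u | u ∈ V }}`. -/
noncomputable def LGraph.allMultiset {L : Finset LAB} (G : LGraph L) {Q : Type} (x : G.V → Q) :
    Multiset Q :=
  (Set.toFinite (Set.univ : Set G.V)).toFinset.val.map x

theorem LGraph.Iso.outMultiset_eq {L : Finset LAB} {G H : LGraph L} (e : G.Iso H) {Q : Type}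
    {x : G.V → Q} {y : H.V → Q} (h : ∀ u, x u = y (e.toEquiv u)) (v : G.V) :
    G.outMultiset x v = H.outMultiset y (e.toEquiv v) := by
  have hs : (Set.toFinite {u | H.E (e.toEquiv v) u}).toFinset =
      (Set.toFinite {u | G.E v u}).toFinset.map e.toEquiv.toEmbedding := by
    ext u
    simp only [Set.Finite.mem_toFinset, Set.mem_ofPred_eq, Finset.mem_map_equiv]
    rw [e.edge]
    simp
  unfold LGraph.outMultiset
  rw [hs, Finset.map_val, Multiset.map_map]
  exact Multiset.map_congr rfl fun u _ => h u

theorem LGraph.Iso.allMultiset_eq {L : Finset LAB} {G H : LGraph L} (e : G.Iso H) {Q : Type}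
    {x : G.V → Q} {y : H.V → Q} (h : ∀ u, x u = y (e.toEquiv u)) :
    G.allMultiset x = H.allMultiset y := by
  have hs : (Set.toFinite (Set.univ : Set H.V)).toFinset =
      (Set.toFinite (Set.univ : Set G.V)).toFinset.map e.toEquiv.toEmbedding := by
    ext u
    simp [Finset.mem_map_equiv]
  unfold LGraph.allMultiset
  rw [hs, Finset.map_val, Multiset.map_map]
  exact Multiset.map_congr rfl fun u _ => h u

/-! ### Pointed graph classifiers and classification systems -/

/-- Isomorphism-invariant functions from pointed labeled graphs to `T`. -/
structure PointedGraphClassifier (L : Finset LAB) (T : Type*) where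
  toFun : (G : LGraph L) → G.V → T
  iso_invariant : ∀ (G H : LGraph L) (e : G.Iso H) (v : G.V), toFun G v = toFun H (e.toEquiv v)

/-- Two pointed graph classifiers are equivalent if they agree on all pointed graphs. -/
def PointedGraphClassifier.Equivalent {L : Finset LAB} {T : Type*}
    (K K' : PointedGraphClassifier L T) : Prop :=
  ∀ (G : LGraph L) (v : G.V), K.toFun G v = K'.toFun G v

/-- Two classification systems have the same expressive power. -/
def SameExpressivePower {L : Finset LAB} {T : Type*}
    (𝒦 𝒦' : Set (PointedGraphClassifier L T)) : Prop :=
  (∀ K ∈ 𝒦, ∃ K' ∈ 𝒦', K.Equivalent K') ∧ (∀ K' ∈ 𝒦', ∃ K ∈ 𝒦, K'.Equivalent K)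

/-! ### Runs -/

/-- Run-skeletons over `V` w.r.t. `S`: sequences of partial labelings `V ⇀ S` (`none` means
undefined) with decreasing domains. -/
structure RunSkeleton (V S : Type) where
  lbl : ℕ → V → Option S
  dom : ∀ i v, (lbl (i + 1) v).isSome → (lbl i v).isSome

theorem RunSkeleton.dom_of_le {V S : Type} (r : RunSkeleton V S) {i j : ℕ} (h : i ≤ j) (v : V) :
    (r.lbl j v).isSome → (r.lbl i v).isSome := by
  induction h with
  | refl => exact id
  | step _ ih => exact fun hj => ih (r.dom _ v hj)

/-- The run-skeleton in which all nodes are labeled in all rounds. -/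
def RunSkeleton.total {V S : Type} (x : ℕ → V → S) : RunSkeleton V S where
  lbl i v := some (x i v)
  dom _ _ _ := rfl

/-- Pointed runs `(r, f, v)` w.r.t. `(S, A)`, over arbitrary domains `V`. -/
structure PRun (S : Type) (A : Type*) where
  V : Type
  r : RunSkeleton V S
  f : S → A
  v : V

/-- Pointed attention runs `(r, f, α, v)` w.r.t. `(S, A)`, over arbitrary domains `V`. -/
structure PaRun (S : Type) (A : Type*) where
  V : Type
  r : RunSkeleton V S
  f : S → A
  α : RunSkeleton V Bool
  v : V

/-- `i` is the `k`th attention round at `u` (`k = 1, 2, …`). -/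
def IsAttentionRound {V : Type} (α : RunSkeleton V Bool) (u : V) (k i : ℕ) : Prop :=
  α.lbl i u = some true ∧ {j | j < i ∧ α.lbl j u = some true}.ncard + 1 = k

theorem isAttentionRound_pred {V : Type} {α : RunSkeleton V Bool} {u : V} {k i : ℕ}
    (h : IsAttentionRound α u (k + 2) i) : ∃ i' ≤ i, IsAttentionRound α u (k + 1) i' := by
  have hfin : ∀ n : ℕ, {j | j < n ∧ α.lbl j u = some true}.Finite := fun n =>
    (Set.finite_Iio n).subset fun j hj => hj.1
  have hcard : {j | j < i ∧ α.lbl j u = some true}.ncard = k + 1 := by have := h.2; omega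
  have hne : {j | j < i ∧ α.lbl j u = some true}.Nonempty := by
    rw [← Set.ncard_pos (hfin i)]; omega
  obtain ⟨m, hm, hmax⟩ := Set.exists_max_image _ id (hfin i) hne
  refine ⟨m, hm.1.le, hm.2, ?_⟩
  have hins : {j | j < i ∧ α.lbl j u = some true} =
      insert m {j | j < m ∧ α.lbl j u = some true} := by
    ext j
    simp only [Set.mem_ofPred_eq, Set.mem_insert_iff]
    constructor
    · intro hj
      rcases (hmax j hj).lt_or_eq with hlt | heq
      · exact Or.inr ⟨hlt, hj.2⟩
      · exact Or.inl heq
    · rintro (rfl | hj)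
      · exact hm
      · exact ⟨hj.1.trans hm.1, hj.2⟩
  rw [hins, Set.ncard_insert_of_notMem (by simp) (hfin m)] at hcard
  omega

theorem isAttentionRound_unique {V : Type} {α : RunSkeleton V Bool} {u : V} {k i i' : ℕ}
    (h : IsAttentionRound α u k i) (h' : IsAttentionRound α u k i') : i = i' := by
  have key : ∀ {a b : ℕ}, IsAttentionRound α u k a → IsAttentionRound α u k b → ¬ a < b := by
    intro a b ha hb hab
    have hfin : {j | j < b ∧ α.lbl j u = some true}.Finite :=
      (Set.finite_Iio b).subset fun j hj => hj.1
    have hlt := Set.ncard_lt_ncard (s := {j | j < a ∧ α.lbl j u = some true})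
      (t := {j | j < b ∧ α.lbl j u = some true})
      ⟨fun j hj => ⟨hj.1.trans hab, hj.2⟩, fun hsub => (lt_irrefl a) (hsub ⟨hab, ha.1⟩).1⟩ hfin
    have := ha.2
    have := hb.2
    omega
  have h1 := key h h'
  have h2 := key h' h
  omega

open Classical in
/-- Removal of the unimportant rounds: the label in round `k` is the old label of the
`(k+1)`th attention round, and is undefined if there is no such attention round. -/
noncomputable def RunSkeleton.process {V S : Type} (r : RunSkeleton V S) (α : RunSkeleton V Bool) :
    RunSkeleton V S where
  lbl k u := if h : ∃ i, IsAttentionRound α u (k + 1) i then r.lbl h.choose u else none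
  dom k u hk := by
    by_cases h : ∃ i, IsAttentionRound α u (k + 1 + 1) i
    · rw [dif_pos h] at hk
      obtain ⟨i', hle, hi'⟩ := isAttentionRound_pred h.choose_spec
      have h' : ∃ i, IsAttentionRound α u (k + 1) i := ⟨i', hi'⟩
      rw [dif_pos h', isAttentionRound_unique h'.choose_spec hi']
      exact r.dom_of_le hle u hk
    · rw [dif_neg h] at hk
      simp at hk

/-- The attention-processing function. -/
noncomputable def PaRun.process {S : Type} {A : Type*} (ρ : PaRun S A) : PRun S A where
  V := ρ.V
  r := ρ.r.process ρ.α
  f := ρ.f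
  v := ρ.v

/-- Domain-isomorphism of pointed runs: only the names of the domain elements differ. -/
def PRun.DomainIso {S : Type} {A : Type*} (ρ ρ' : PRun S A) : Prop :=
  ρ.f = ρ'.f ∧ ∃ g : ρ.V ≃ ρ'.V, g ρ.v = ρ'.v ∧ ∀ i u, ρ.r.lbl i u = ρ'.r.lbl i (g u)

/-- Domain-isomorphism of pointed attention runs. -/
def PaRun.DomainIso {S : Type} {A : Type*} (ρ ρ' : PaRun S A) : Prop :=
  ρ.f = ρ'.f ∧ ∃ g : ρ.V ≃ ρ'.V, g ρ.v = ρ'.v ∧ (∀ i u, ρ.r.lbl i u = ρ'.r.lbl i (g u)) ∧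
    ∀ i u, ρ.α.lbl i u = ρ'.α.lbl i (g u)

/-- The data of a color similarity: partitions of two sets of colors and a bijection between
them. -/
structure ColorSimilarity (A A' : Type*) where
  cells : Set (Set A)
  cells' : Set (Set A')
  isPartition : Setoid.IsPartition cells
  isPartition' : Setoid.IsPartition cells'
  p : cells ≃ cells'

/-- The relation `s ∼ s'` induced by a color similarity on configuration labels colored by the
assignments `f` and `f'`: the colors of `s` and `s'` lie in corresponding cells. -/
def ColorSimilarity.Rel {A A' : Type*} (σ : ColorSimilarity A A') {S S' : Type} (f : S → A)
    (f' : S' → A') (s : S) (s' : S') : Prop :=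
  ∃ P : σ.cells, f s ∈ (P : Set A) ∧ f' s' ∈ (σ.p P : Set A')

/-- Run-similarity of pointed attention runs; labels in corresponding positions are either both
undefined or both defined and similar. -/
def RunSimilar {A A' : Type*} (σ : ColorSimilarity A A') {S S' : Type} (ρ : PaRun S A)
    (ρ' : PaRun S' A') : Prop :=
  ∃ g : ρ.V ≃ ρ'.V, g ρ.v = ρ'.v ∧
    (∀ i u, Option.Rel (σ.Rel ρ.f ρ'.f) (ρ.r.lbl i u) (ρ'.r.lbl i (g u))) ∧
    ∀ i u, ρ.α.lbl i u = ρ'.α.lbl i (g u)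

/-- Pa-run classifications w.r.t. `(S, A)`. -/
structure PaRunClassification (S : Type) (A T : Type*) where
  toFun : PaRun S A → T
  invariant : ∀ ρ ρ', ρ.DomainIso ρ' → toFun ρ = toFun ρ'

/-- Attention-invariance: the value only depends on the attention-processed run. -/
def PaRunClassification.AttentionInvariant {S : Type} {A T : Type*}
    (C : PaRunClassification S A T) : Prop :=
  ∀ ρ ρ' : PaRun S A, ρ.process.DomainIso ρ'.process → C.toFun ρ = C.toFun ρ'

/-- Equivalence of pa-run classifications w.r.t. a color similarity. -/
def PaRunClassification.EquivalentWrt {S S' : Type} {A A' T : Type*} (σ : ColorSimilarity A A')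
    (C : PaRunClassification S A T) (C' : PaRunClassification S' A' T) : Prop :=
  ∀ ρ ρ', RunSimilar σ ρ ρ' → C.toFun ρ = C'.toFun ρ'

/-! ### Attention run-generators -/

/-- Attention functions: each graph is assigned a run-skeleton over its nodes w.r.t. `{0,1}`, in an
isomorphism-invariant way. -/
structure AttentionFunction (L : Finset LAB) where
  toFun : (G : LGraph L) → RunSkeleton G.V Bool
  iso_invariant : ∀ (G H : LGraph L) (e : G.Iso H) (i : ℕ) (u : G.V),
    (toFun G).lbl i u = (toFun H).lbl i (e.toEquiv u)

/-- Attention run-generators over `L` w.r.t. `(S, A)`: an assignment, and for each graph a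
run-skeleton and an attention run-skeleton over its nodes, respecting isomorphisms. -/
structure AttentionRunGenerator (L : Finset LAB) (S : Type) (A : Type*) where
  f : S → A
  r : (G : LGraph L) → RunSkeleton G.V S
  α : AttentionFunction L
  iso_invariant : ∀ (G H : LGraph L) (e : G.Iso H) (i : ℕ) (u : G.V),
    (r G).lbl i u = (r H).lbl i (e.toEquiv u)

/-- The pointed attention run generated in a pointed graph. -/
def AttentionRunGenerator.paRun {L : Finset LAB} {S : Type} {A : Type*}
    (R : AttentionRunGenerator L S A) (G : LGraph L) (v : G.V) : PaRun S A where
  V := G.V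
  r := R.r G
  f := R.f
  α := R.α.toFun G
  v := v

/-- A run-generator paired with a classification of its runs is a pointed graph classifier. -/
def AttentionRunGenerator.classifier {L : Finset LAB} {S : Type} {A T : Type*}
    (R : AttentionRunGenerator L S A) (C : PaRunClassification S A T) :
    PointedGraphClassifier L T where
  toFun G v := C.toFun (R.paRun G v)
  iso_invariant G H e _ := C.invariant _ _
    ⟨rfl, e.toEquiv, rfl, R.iso_invariant G H e, R.α.iso_invariant G H e⟩

/-- A class of attention run-generators with colors `A`. Its members may use different sets of
configuration labels; `Label` lists these sets. -/
structure PreClassificationSystem (L : Finset LAB) (A : Type*) where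
  Idx : Type
  Label : Idx → Type
  gen : ∀ i, Set (AttentionRunGenerator L (Label i) A)

/-- A pa-run classifier for a class of attention run-generators: a classification for each set of
configuration labels in use, the same one for all run-generators with these labels. -/
abbrev PreClassificationSystem.Classifier {L : Finset LAB} {A : Type*}
    (ℛ : PreClassificationSystem L A) (T : Type*) :=
  ∀ i, PaRunClassification (ℛ.Label i) A T

/-- The uniform classification system `(ℛ, C)`. -/
def PreClassificationSystem.uniform {L : Finset LAB} {A T : Type*}
    (ℛ : PreClassificationSystem L A) (C : ℛ.Classifier T) : Set (PointedGraphClassifier L T) :=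
  {K | ∃ i, ∃ R ∈ ℛ.gen i, K = R.classifier (C i)}

/-- Two classes of attention run-generators over `L` have the same expressive power with any
attention-invariant pa-run classifiers that are equivalent w.r.t. the color similarity `σ`. -/
def SameExpressivePowerWrt {L : Finset LAB} {A A' : Type*} (T : Type*) (σ : ColorSimilarity A A')
    (ℛ : PreClassificationSystem L A) (ℛ' : PreClassificationSystem L A') : Prop :=
  ∀ (C : ℛ.Classifier T) (C' : ℛ'.Classifier T),
    (∀ i, (C i).AttentionInvariant) → (∀ j, (C' j).AttentionInvariant) →
    (∀ i j, (C i).EquivalentWrt σ (C' j)) →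
    SameExpressivePower (ℛ.uniform C) (ℛ'.uniform C')

/-! ### Graded modal substitution calculus -/

/-- The countable set of schema variable symbols. -/
abbrev VAR := ℕ

/-- Schemata over node label symbols `P` and schema variables `X`. The counting global modality
`⟨e⟩_{≥ k}` is available if and only if `g = true`. -/
inductive Schema (g : Bool) (P X : Type) : Type
  | top : Schema g P X
  | symb : P → Schema g P X
  | var : X → Schema g P X
  | neg : Schema g P X → Schema g P X
  | and : Schema g P X → Schema g P X → Schema g P X
  | dia : ℕ → Schema g P X → Schema g P X
  | gdia : g = true → ℕ → Schema g P X → Schema g P X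

/-- Formulae of graded modal logic, with counting global modality if `g = true`. -/
abbrev Formula (g : Bool) (P : Type) := Schema g P Empty

/-- Replacing the schema variables by formulae. -/
def Schema.subst {g : Bool} {P X : Type} (σ : X → Formula g P) : Schema g P X → Formula g P
  | top => top
  | symb p => symb p
  | var x => σ x
  | neg φ => neg (φ.subst σ)
  | and φ ψ => and (φ.subst σ) (ψ.subst σ)
  | dia k φ => dia k (φ.subst σ)
  | gdia h k φ => gdia h k (φ.subst σ)

/-- Truth of a formula in a pointed graph. -/
def Schema.Sat {g : Bool} {L : Finset LAB} (G : LGraph L) : G.V → Formula g L → Prop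
  | _, top => True
  | v, symb p => p ∈ G.lab v
  | v, neg φ => ¬ Sat G v φ
  | v, and φ ψ => Sat G v φ ∧ Sat G v ψ
  | v, dia k φ => k ≤ {u | G.E v u ∧ Sat G u φ}.ncard
  | _, gdia _ k φ => k ≤ {u | Sat G u φ}.ncard

theorem Schema.sat_iso {g : Bool} {L : Finset LAB} {G H : LGraph L} (e : G.Iso H)
    (φ : Formula g L) : ∀ v, Schema.Sat G v φ ↔ Schema.Sat H (e.toEquiv v) φ := by
  induction φ with
  | top => intro v; simp [Schema.Sat]
  | symb p => intro v; simp [Schema.Sat, e.lab]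
  | var x => exact x.elim
  | neg φ ih => intro v; simp [Schema.Sat, ih]
  | and φ ψ ih ih' => intro v; simp [Schema.Sat, ih, ih']
  | dia k φ ih =>
    intro v
    have : {u | H.E (e.toEquiv v) u ∧ Sat H u φ} =
        e.toEquiv '' {u | G.E v u ∧ Sat G u φ} := by
      ext u
      obtain ⟨w, rfl⟩ := e.toEquiv.surjective u
      simp [e.edge, ih]
    simp only [Schema.Sat]
    rw [this, Set.ncard_image_of_injective _ e.toEquiv.injective]
  | gdia h k φ ih =>
    intro v
    have : {u | Sat H u φ} = e.toEquiv '' {u | Sat G u φ} := by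
      ext u
      obtain ⟨w, rfl⟩ := e.toEquiv.surjective u
      simp [ih]
    simp only [Schema.Sat]
    rw [this, Set.ncard_image_of_injective _ e.toEquiv.injective]

/-- `(L, 𝒯)`-programs of GMSC (of GMSC with counting global modality if `g = true`): the bodies
of the terminal clauses and of the iteration clauses. -/
structure GMSCProgram (g : Bool) (L : Finset LAB) (𝒯 : Finset VAR) where
  terminal : 𝒯 → Formula g L
  iteration : 𝒯 → Schema g L 𝒯

/-- The `n`th iteration formula of a head predicate. -/
def GMSCProgram.iter {g : Bool} {L : Finset LAB} {𝒯 : Finset VAR} (Λ : GMSCProgram g L 𝒯) :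
    ℕ → 𝒯 → Formula g L
  | 0, X => Λ.terminal X
  | n + 1, X => (Λ.iteration X).subst (Λ.iter n)

/-- A program with an attention function and an assignment, as an attention run-generator: in round
`i`, a node is labeled with the set of head predicates whose `i`th iteration formula is true. -/
def GMSCProgram.generator {g : Bool} {L : Finset LAB} {𝒯 : Finset VAR} {A : Type*}
    (Λ : GMSCProgram g L 𝒯) (att : AttentionFunction L) (f : Set 𝒯 → A) :
    AttentionRunGenerator L (Set 𝒯) A where
  f := f
  r G := RunSkeleton.total fun i u => {X | Schema.Sat G u (Λ.iter i X)}
  α := att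
  iso_invariant G H e i u := by
    simp only [RunSkeleton.total, Option.some.injEq]
    ext X
    exact Schema.sat_iso e _ u

/-- Generalized GMSC+AG (`g = true`) and generalized GMSC+A (`g = false`) with colors `A`. -/
def GMSC (g : Bool) (L : Finset LAB) (A : Type*) : PreClassificationSystem L A where
  Idx := Finset VAR
  Label 𝒯 := Set 𝒯
  gen 𝒯 := {R | ∃ (Λ : GMSCProgram g L 𝒯) (att : AttentionFunction L) (f : Set 𝒯 → A),
    R = Λ.generator att f}

/-! ### Floating-point systems -/

/-- The parameters of a floating-point system: number of digits, exponent bound and base. -/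
structure FloatSystem where
  p : ℕ
  n : ℕ
  β : ℕ
  hp : 1 ≤ p
  hβ : 2 ≤ β

/-- `q` is `± 0.d₁…d_p × β ^ e` where `±d₁…d_p` is the integer `m` in base `β`. -/
def FloatSystem.IsRep (F : FloatSystem) (q : ℚ) (m e : ℤ) : Prop :=
  |m| < (F.β : ℤ) ^ F.p ∧ -(F.n : ℤ) ≤ e ∧ e ≤ F.n ∧ q = m * (F.β : ℚ) ^ (e - F.p)

/-- The floats of a floating-point system, a set of rationals ordered as such. -/
abbrev FloatSystem.Carrier (F : FloatSystem) : Type := {q : ℚ // ∃ m e, F.IsRep q m e}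

theorem FloatSystem.isRep_zero (F : FloatSystem) : F.IsRep 0 0 0 := by
  have := F.hβ
  refine ⟨by simp; positivity, by simp, by simp, by simp⟩

instance (F : FloatSystem) : Zero F.Carrier := ⟨⟨0, 0, 0, F.isRep_zero⟩⟩

instance (F : FloatSystem) : Finite F.Carrier := by
  let B : ℤ := (F.β : ℤ) ^ F.p
  have hfin : ((fun x : ℤ × ℤ => (x.1 : ℚ) * (F.β : ℚ) ^ (x.2 - F.p)) ''
      (Set.Icc (-B) B ×ˢ Set.Icc (-(F.n : ℤ)) F.n)).Finite :=
    ((Set.finite_Icc _ _).prod (Set.finite_Icc _ _)).image _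
  refine Set.Finite.to_subtype (hfin.subset ?_)
  rintro q ⟨m, e, hm, h1, h2, rfl⟩
  exact ⟨(m, e), ⟨⟨(abs_lt.1 hm).1.le, (abs_lt.1 hm).2.le⟩, h1, h2⟩, rfl⟩

/-- The least significant digit of `x` is even, in the representation of `x` with the least
exponent. -/
def FloatSystem.EvenLSD (F : FloatSystem) (x : F.Carrier) : Prop :=
  ∃ m e, F.IsRep x m e ∧ (∀ m' e', F.IsRep x m' e' → e ≤ e') ∧ Even (m.natAbs % F.β)

/-- `x` is a float closest to `q`. -/
def FloatSystem.IsNearest (F : FloatSystem) (q : ℚ) (x : F.Carrier) : Prop :=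
  ∀ y : F.Carrier, |q - x| ≤ |q - y|

/-- `x` is the float closest to `q`; among two closest floats it is the one with an even least
significant digit, and if this does not single out one of them (which only happens if there is
just one digit or the base is odd), it is the one that is larger in magnitude. -/
def FloatSystem.IsRounding (F : FloatSystem) (q : ℚ) (x : F.Carrier) : Prop :=
  F.IsNearest q x ∧ ∀ y, F.IsNearest q y → y ≠ x →
    (F.EvenLSD x ∧ ¬ F.EvenLSD y) ∨ ((F.EvenLSD x ↔ F.EvenLSD y) ∧ |(y : ℚ)| < |(x : ℚ)|)

theorem FloatSystem.existsUnique_isRounding (F : FloatSystem) (q : ℚ) :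
    ∃! x, F.IsRounding q x := by
  have hne : ∃ x, F.IsNearest q x := Finite.exists_min fun x : F.Carrier => |q - x|
  have hdist : ∀ x y, F.IsNearest q x → F.IsNearest q y → |q - x| = |q - y| := fun x y hx hy =>
    le_antisymm (hx y) (hy x)
  -- of three closest floats, two are equal
  have hthree : ∀ x y z, F.IsNearest q x → F.IsNearest q y → F.IsNearest q z →
      x ≠ y → z = x ∨ z = y := by
    intro x y z hx hy hz hxy
    have h1 := hdist x y hx hy
    have h2 := hdist x z hx hz
    have h3 := hdist y z hy hz
    have hxy' : (x : ℚ) ≠ y := fun h => hxy (Subtype.ext h)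
    rcases abs_eq_abs.1 h1 with h1 | h1
    · exact absurd (by linarith) hxy'
    rcases abs_eq_abs.1 h2 with h2 | h2
    · exact Or.inl (Subtype.ext (by linarith))
    · exact Or.inr (Subtype.ext (by linarith))
  have habs : ∀ x y, F.IsNearest q x → F.IsNearest q y → x ≠ y → |(x : ℚ)| ≠ |(y : ℚ)| := by
    intro x y hx hy hxy h
    have hxy' : (x : ℚ) ≠ y := fun h => hxy (Subtype.ext h)
    have h1 := hdist x y hx hy
    rcases abs_eq_abs.1 h1 with h1 | h1
    · exact hxy' (by linarith)
    rcases abs_eq_abs.1 h with h | h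
    · exact hxy' h
    have hq : q = 0 := by linarith
    have h0 := hx 0
    have hz : ((0 : F.Carrier) : ℚ) = 0 := rfl
    rw [hq, hz] at h0
    have hx0 : (x : ℚ) = 0 := by simpa using h0
    exact hxy' (by rw [hx0] at h ⊢; linarith)
  have huniq : ∀ x y, F.IsRounding q x → F.IsRounding q y → y = x := by
    intro x y hx hy
    by_contra hxy
    have h1 := hx.2 y hy.1 hxy
    have h2 := hy.2 x hx.1 (Ne.symm hxy)
    rcases h1 with h1 | h1 <;> rcases h2 with h2 | h2
    · exact h1.2 h2.1
    · exact h1.2 (h2.1.2 h1.1)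
    · exact h2.2 (h1.1.2 h2.1)
    · exact lt_asymm h1.2 h2.2
  suffices ∃ x, F.IsRounding q x by
    obtain ⟨x, hx⟩ := this
    exact ⟨x, hx, fun y hy => huniq x y hx hy⟩
  obtain ⟨x, hx⟩ := hne
  by_cases hy : ∃ y, F.IsNearest q y ∧ y ≠ x
  · obtain ⟨y, hy, hyx⟩ := hy
    have pick : ∀ a b, F.IsNearest q a → F.IsNearest q b → b ≠ a →
        ((F.EvenLSD a ∧ ¬ F.EvenLSD b) ∨
          ((F.EvenLSD a ↔ F.EvenLSD b) ∧ |(b : ℚ)| < |(a : ℚ)|)) → F.IsRounding q a := by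
      intro a b ha hb hba h
      refine ⟨ha, fun c hc hca => ?_⟩
      rcases hthree a b c ha hb hc (Ne.symm hba) with rfl | rfl
      · exact absurd rfl hca
      · exact h
    by_cases e1 : F.EvenLSD x <;> by_cases e2 : F.EvenLSD y
    · rcases lt_or_gt_of_ne (habs y x hy hx hyx) with h | h
      · exact ⟨x, pick x y hx hy hyx (Or.inr ⟨by tauto, h⟩)⟩
      · exact ⟨y, pick y x hy hx (Ne.symm hyx) (Or.inr ⟨by tauto, h⟩)⟩
    · exact ⟨x, pick x y hx hy hyx (Or.inl ⟨e1, e2⟩)⟩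
    · exact ⟨y, pick y x hy hx (Ne.symm hyx) (Or.inl ⟨e2, e1⟩)⟩
    · rcases lt_or_gt_of_ne (habs y x hy hx hyx) with h | h
      · exact ⟨x, pick x y hx hy hyx (Or.inr ⟨by tauto, h⟩)⟩
      · exact ⟨y, pick y x hy hx (Ne.symm hyx) (Or.inr ⟨by tauto, h⟩)⟩
  · push Not at hy
    exact ⟨x, hx, fun y hny hne => absurd (hy y hny) hne⟩

/-- Rounding to the closest float. -/
noncomputable def FloatSystem.round (F : FloatSystem) (q : ℚ) : F.Carrier :=
  (F.existsUnique_isRounding q).choose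

/-- Float addition: the precise sum, rounded. -/
noncomputable def FloatSystem.add (F : FloatSystem) (x y : F.Carrier) : F.Carrier :=
  F.round ((x : ℚ) + y)

/-- Float multiplication: the precise product, rounded. -/
noncomputable def FloatSystem.mul (F : FloatSystem) (x y : F.Carrier) : F.Carrier :=
  F.round ((x : ℚ) * y)

/-- The sum of a list of floats from left to right. -/
noncomputable def FloatSystem.listSum (F : FloatSystem) (l : List F.Carrier) : F.Carrier :=
  l.foldl F.add 0

/-- `SUM_S`: the floats of the multiset are added up in increasing order. -/
noncomputable def FloatSystem.sum (F : FloatSystem) (M : Multiset F.Carrier) : F.Carrier :=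
  F.listSum (M.sort (· ≤ ·))

/-- The truncated ReLU, `min (max 0 x) 1`. For a float `x` this value is itself a float, so that
`round` does not change it. -/
noncomputable def FloatSystem.reluStar (F : FloatSystem) (x : F.Carrier) : F.Carrier :=
  F.round (min (max 0 (x : ℚ)) 1)

/-- Feature vectors of dimension `d` over the floats. -/
abbrev FloatSystem.Vec (F : FloatSystem) (d : ℕ+) : Type := Fin d → F.Carrier

/-- Componentwise float addition. -/
noncomputable def FloatSystem.vecAdd (F : FloatSystem) {d : ℕ+} (x y : F.Vec d) : F.Vec d :=
  fun l => F.add (x l) (y l)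

/-- The product `x · C` of a row vector and a matrix, in float arithmetic. -/
noncomputable def FloatSystem.vecMul (F : FloatSystem) {d : ℕ+} (x : F.Vec d)
    (C : Matrix (Fin d) (Fin d) F.Carrier) : F.Vec d :=
  fun l => F.listSum (List.ofFn fun k => F.mul (x k) (C k l))

/-- `SUM_S`, applied separately to each component. -/
noncomputable def FloatSystem.vecSum (F : FloatSystem) {d : ℕ+} (M : Multiset (F.Vec d)) :
    F.Vec d :=
  fun l => F.sum (M.map fun x => x l)

/-! ### Graph neural networks with floats -/

open Classical in
/-- The `k`-projection of a multiset. -/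
noncomputable def kProj {Q : Type} (k : ℕ) (M : Multiset Q) : Multiset Q :=
  M ∩ k • M.dedup

open Classical in
theorem count_kProj {Q : Type} (k : ℕ) (M : Multiset Q) (x : Q) :
    (kProj k M).count x = min (M.count x) k := by
  unfold kProj
  rw [Multiset.count_inter, Multiset.count_nsmul, Multiset.count_dedup]
  by_cases h : x ∈ M
  · simp [h]
  · simp [h]

/-- A function of multisets that only counts multiplicities up to some bound. -/
def IsBounded {Q Q' : Type} (F : Multiset Q → Q') : Prop :=
  ∃ k, ∀ M, F M = F (kProj k M)

/-- GNN[F]s over `L` with states in `F.Vec d`. -/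
structure GNNF (L : Finset LAB) (F : FloatSystem) (d : ℕ+) where
  init : Set L → F.Vec d
  agg : Multiset (F.Vec d) → F.Vec d
  com : F.Vec d → F.Vec d → F.Vec d
  bounded : IsBounded agg

/-- GNN[F]s with global readout over `L` with states in `F.Vec d`. -/
structure GNNFG (L : Finset LAB) (F : FloatSystem) (d : ℕ+) where
  init : Set L → F.Vec d
  agg : Multiset (F.Vec d) → F.Vec d
  read : Multiset (F.Vec d) → F.Vec d
  com : F.Vec d → F.Vec d → F.Vec d → F.Vec d
  bounded : IsBounded agg
  bounded_read : IsBounded read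

/-- The feature vector of a node in a round. -/
noncomputable def GNNF.state {L : Finset LAB} {F : FloatSystem} {d : ℕ+} (N : GNNF L F d)
    (G : LGraph L) : ℕ → G.V → F.Vec d
  | 0, v => N.init (G.lab v)
  | t + 1, v => N.com (N.state G t v) (N.agg (G.outMultiset (N.state G t) v))

/-- The feature vector of a node in a round, with global readout. -/
noncomputable def GNNFG.state {L : Finset LAB} {F : FloatSystem} {d : ℕ+} (N : GNNFG L F d)
    (G : LGraph L) : ℕ → G.V → F.Vec d
  | 0, v => N.init (G.lab v)
  | t + 1, v => N.com (N.state G t v) (N.agg (G.outMultiset (N.state G t) v))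
      (N.read (G.allMultiset (N.state G t)))

theorem GNNF.state_iso {L : Finset LAB} {F : FloatSystem} {d : ℕ+} (N : GNNF L F d)
    {G H : LGraph L} (e : G.Iso H) (t : ℕ) :
    ∀ u, N.state G t u = N.state H t (e.toEquiv u) := by
  induction t with
  | zero => intro u; simp only [GNNF.state, e.lab]
  | succ t ih => intro u; simp only [GNNF.state]; rw [ih u, e.outMultiset_eq ih u]

theorem GNNFG.state_iso {L : Finset LAB} {F : FloatSystem} {d : ℕ+} (N : GNNFG L F d)
    {G H : LGraph L} (e : G.Iso H) (t : ℕ) :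
    ∀ u, N.state G t u = N.state H t (e.toEquiv u) := by
  induction t with
  | zero => intro u; simp only [GNNFG.state, e.lab]
  | succ t ih =>
    intro u; simp only [GNNFG.state]; rw [ih u, e.outMultiset_eq ih u, e.allMultiset_eq ih]

/-- A GNN[F] with an attention function and an assignment, as an attention run-generator. -/
noncomputable def GNNF.generator {L : Finset LAB} {F : FloatSystem} {d : ℕ+} {A : Type*}
    (N : GNNF L F d) (att : AttentionFunction L) (f : F.Vec d → A) :
    AttentionRunGenerator L (F.Vec d) A where
  f := f
  r G := RunSkeleton.total (N.state G)
  α := att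
  iso_invariant _ _ e i u := congrArg some (N.state_iso e i u)

/-- A GNN[F] with global readout, an attention function and an assignment, as an attention
run-generator. -/
noncomputable def GNNFG.generator {L : Finset LAB} {F : FloatSystem} {d : ℕ+} {A : Type*}
    (N : GNNFG L F d) (att : AttentionFunction L) (f : F.Vec d → A) :
    AttentionRunGenerator L (F.Vec d) A where
  f := f
  r G := RunSkeleton.total (N.state G)
  α := att
  iso_invariant _ _ e i u := congrArg some (N.state_iso e i u)

/-- R-simple aggregate-combine GNN[F]s: `AGG` is the float sum and
`COM(x, y) = ReLU*(x · C + y · A + b)`. -/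
def GNNF.IsRSimple {L : Finset LAB} {F : FloatSystem} {d : ℕ+} (N : GNNF L F d) : Prop :=
  N.agg = F.vecSum ∧ ∃ (C A : Matrix (Fin d) (Fin d) F.Carrier) (b : F.Vec d),
    ∀ x y l, N.com x y l =
      F.reluStar (F.vecAdd (F.vecAdd (F.vecMul x C) (F.vecMul y A)) b l)

/-- R-simple aggregate-combine GNN[F]s with global readout: `AGG` and `READ` are the float sum and
`COM(x, y, z) = ReLU*(x · C + y · A + z · R + b)`. -/
def GNNFG.IsRSimple {L : Finset LAB} {F : FloatSystem} {d : ℕ+} (N : GNNFG L F d) : Prop :=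
  N.agg = F.vecSum ∧ N.read = F.vecSum ∧
    ∃ (C A R : Matrix (Fin d) (Fin d) F.Carrier) (b : F.Vec d),
      ∀ x y z l, N.com x y z l =
        F.reluStar (F.vecAdd
          (F.vecAdd (F.vecAdd (F.vecMul x C) (F.vecMul y A)) (F.vecMul z R)) b l)

/-- Generalized GNN[F]+As with colors `B`, over all floating-point systems and dimensions. -/
def GNNA (L : Finset LAB) (B : Type*) : PreClassificationSystem L B where
  Idx := FloatSystem × ℕ+
  Label i := i.1.Vec i.2
  gen i := {R | ∃ (N : GNNF L i.1 i.2) (att : AttentionFunction L) (f : i.1.Vec i.2 → B),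
    R = N.generator att f}

/-- Generalized R-simple aggregate-combine GNN[F]+As with colors `B`. -/
def RSimpleGNNA (L : Finset LAB) (B : Type*) : PreClassificationSystem L B where
  Idx := FloatSystem × ℕ+
  Label i := i.1.Vec i.2
  gen i := {R | ∃ (N : GNNF L i.1 i.2) (att : AttentionFunction L) (f : i.1.Vec i.2 → B),
    N.IsRSimple ∧ R = N.generator att f}

/-- Generalized GNN[F]+AGs with colors `B`. -/
def GNNAG (L : Finset LAB) (B : Type*) : PreClassificationSystem L B where
  Idx := FloatSystem × ℕ+
  Label i := i.1.Vec i.2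
  gen i := {R | ∃ (N : GNNFG L i.1 i.2) (att : AttentionFunction L) (f : i.1.Vec i.2 → B),
    R = N.generator att f}

/-- Generalized R-simple aggregate-combine GNN[F]+AGs with colors `B`. -/
def RSimpleGNNAG (L : Finset LAB) (B : Type*) : PreClassificationSystem L B where
  Idx := FloatSystem × ℕ+
  Label i := i.1.Vec i.2
  gen i := {R | ∃ (N : GNNFG L i.1 i.2) (att : AttentionFunction L) (f : i.1.Vec i.2 → B),
    N.IsRSimple ∧ R = N.generator att f}

end RecGNN

namespace RecGNN

/-! ### Simulation of traces and transfer of classifiers -/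

/-! Attention-invariance makes the speed of a simulation irrelevant. Suppose that a fixed function
decodes the labels of one device from those that another device has in rounds `τ 0 < τ 1 < …`. Let
the second device pay attention in round `τ i` exactly where the first does in round `i`, and color
a label of the second by some color from the cell that corresponds to the color of its decoding.
Deleting the rounds outside the range of `τ` does not change the processed run and leaves a run that
is run-similar to the original one, so equivalent attention-invariant classifiers give the same
value (`exists_equivalent_of_simulatedBy`). This reduces the theorem to simulations of label
sequences along the cycle R-simple GNN[F] → GNN[F] → GMSC → R-simple GNN[F], whose first arrow is an
inclusion.

GNN[F] → GMSC (`CountingAutomaton.exists_program`): there are finitely many states, and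
multiplicities matter only up to a bound, so the next state depends on one of finitely many profiles
of counts. Graded modalities describe each profile. With one head predicate per state, a program
follows the network round by round.

GMSC → R-simple GNN[F]: a program updates all its bodies at once, whereas one layer of an R-simple
network handles a single connective. A body is therefore evaluated one connective per round, and one
iteration of the program takes a fixed number of rounds (`bit_evalNetwork`). Each connective is a
threshold test of an integer linear form in bits and in counts of bits, which `ReLU*` performs
(`Gate.holds_iff`). Float arithmetic is exact on integers of absolute value at most `2 ^ p - 1`, and
sums of bits saturate there, so it suffices to choose `p` such that all thresholds lie below
saturation (`GateNetwork.state_toGNNFG`). That the ordered float sum is an admissible aggregation at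
all is `FloatSystem.isBounded_vecSum`. -/

/-- The configuration labels of all nodes of all graphs in all rounds. -/
abbrev Trace (L : Finset LAB) (S : Type) := (G : LGraph L) → ℕ → G.V → S

/-- `X'` simulates `X` if the labels of `X` can be decoded from those that `X'` has in a subsequence
of its rounds. -/
def Trace.SimulatedBy {L : Finset LAB} {S S' : Type} (X : Trace L S) (X' : Trace L S') : Prop :=
  ∃ (dec : S' → S) (τ : ℕ → ℕ), StrictMono τ ∧ ∀ G t v, dec (X' G (τ t) v) = X G t v

theorem Trace.SimulatedBy.refl {L : Finset LAB} {S : Type} (X : Trace L S) : X.SimulatedBy X :=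
  ⟨id, id, strictMono_id, fun _ _ _ => rfl⟩

theorem Trace.SimulatedBy.trans {L : Finset LAB} {S S' S'' : Type} {X : Trace L S}
    {X' : Trace L S'} {X'' : Trace L S''} (h : X.SimulatedBy X') (h' : X'.SimulatedBy X'') :
    X.SimulatedBy X'' := by
  obtain ⟨d, τ, hτ, h⟩ := h
  obtain ⟨d', τ', hτ', h'⟩ := h'
  exact ⟨d ∘ d', τ' ∘ τ, hτ'.comp hτ, fun G t v => by simp [h', h]⟩

/-- The class `ℛ` consists of the run-generators with traces in `𝒳`, with arbitrary assignments and
attention functions. -/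
structure PreClassificationSystem.HasTraces {L : Finset LAB} {A : Type*}
    (ℛ : PreClassificationSystem L A) (𝒳 : ∀ i, Set (Trace L (ℛ.Label i))) : Prop where
  exists_trace : ∀ i, ∀ R ∈ ℛ.gen i, ∃ X ∈ 𝒳 i, ∀ G, R.r G = RunSkeleton.total (X G)
  exists_gen : ∀ i, ∀ X ∈ 𝒳 i, ∀ (att : AttentionFunction L) (f : ℛ.Label i → A),
    ∃ R ∈ ℛ.gen i, R.f = f ∧ R.α = att ∧ ∀ G, R.r G = RunSkeleton.total (X G)

/-- Attention in those rounds `τ i` for which `α` pays attention in round `i`. -/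
noncomputable def RunSkeleton.reindex {V : Type} (α : RunSkeleton V Bool) (τ : ℕ → ℕ) :
    RunSkeleton V Bool := by
  classical
  exact RunSkeleton.total fun j u => decide (∃ i, τ i = j ∧ α.lbl i u = some true)

theorem RunSkeleton.reindex_eq_true {V : Type} (α : RunSkeleton V Bool) {τ : ℕ → ℕ} {j : ℕ}
    {u : V} : (α.reindex τ).lbl j u = some true ↔ ∃ i, τ i = j ∧ α.lbl i u = some true := by
  simp [RunSkeleton.reindex, RunSkeleton.total]

/-- The attended rounds are exactly the `τ`-images of the old ones; since `τ` is strictly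
increasing, as many of them precede `τ i` as old ones precede `i`. -/
theorem isAttentionRound_reindex {V : Type} (α : RunSkeleton V Bool) {τ : ℕ → ℕ}
    (hτ : StrictMono τ) {k i : ℕ} {u : V} (h : IsAttentionRound α u k i) :
    IsAttentionRound (α.reindex τ) u k (τ i) := by
  refine ⟨(α.reindex_eq_true).2 ⟨i, rfl, h.1⟩, ?_⟩
  rw [← h.2, ← Set.ncard_image_of_injective {j | j < i ∧ α.lbl j u = some true} hτ.injective]
  congr 2
  ext j
  simp only [Set.mem_ofPred_eq, RunSkeleton.reindex_eq_true, Set.mem_image]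
  constructor
  · rintro ⟨hj, a, rfl, ha⟩
    exact ⟨a, ⟨hτ.lt_iff_lt.1 hj, ha⟩, rfl⟩
  · rintro ⟨a, ⟨ha, ha'⟩, rfl⟩
    exact ⟨hτ ha, a, rfl, ha'⟩

/-- An attended round is some `τ i`. Its ordinal is already determined by the forward direction, so
it must be `k`. -/
theorem isAttentionRound_of_reindex {V : Type} (α : RunSkeleton V Bool) {τ : ℕ → ℕ}
    (hτ : StrictMono τ) {k j : ℕ} {u : V} (h : IsAttentionRound (α.reindex τ) u k j) :
    ∃ i, τ i = j ∧ IsAttentionRound α u k i := by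
  obtain ⟨i, rfl, hi⟩ := (α.reindex_eq_true).1 h.1
  have h' : IsAttentionRound α u ({j | j < i ∧ α.lbl j u = some true}.ncard + 1) i := ⟨hi, rfl⟩
  have := (isAttentionRound_reindex α hτ h').2.symm.trans h.2
  exact ⟨i, rfl, this ▸ h'⟩

theorem RunSkeleton.process_lbl {V S : Type} (r : RunSkeleton V S) (α : RunSkeleton V Bool)
    {k i : ℕ} {u : V} (h : IsAttentionRound α u (k + 1) i) :
    (r.process α).lbl k u = r.lbl i u := by
  have h' : ∃ i, IsAttentionRound α u (k + 1) i := ⟨i, h⟩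
  simp only [RunSkeleton.process, dif_pos h']
  rw [isAttentionRound_unique h'.choose_spec h]

theorem RunSkeleton.process_lbl_none {V S : Type} (r : RunSkeleton V S) (α : RunSkeleton V Bool)
    {k : ℕ} {u : V} (h : ¬ ∃ i, IsAttentionRound α u (k + 1) i) :
    (r.process α).lbl k u = none := by
  simp only [RunSkeleton.process, dif_neg h]

/-- This is where the slowdown disappears: rounds of `r'` outside the range of `τ` are never
attended, so the labels there are arbitrary. -/
theorem RunSkeleton.process_reindex {V S : Type} (r r' : RunSkeleton V S) (α : RunSkeleton V Bool)
    {τ : ℕ → ℕ} (hτ : StrictMono τ) (h : ∀ i u, r'.lbl (τ i) u = r.lbl i u) (k : ℕ) (u : V) :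
    (r'.process (α.reindex τ)).lbl k u = (r.process α).lbl k u := by
  by_cases hk : ∃ i, IsAttentionRound α u (k + 1) i
  · obtain ⟨i, hi⟩ := hk
    rw [process_lbl _ _ hi, process_lbl _ _ (isAttentionRound_reindex α hτ hi), h]
  · rw [process_lbl_none _ _ hk, process_lbl_none]
    rintro ⟨j, hj⟩
    obtain ⟨i, -, hi⟩ := isAttentionRound_of_reindex α hτ hj
    exact hk ⟨i, hi⟩

/-- The attention function that skips the rounds outside of the range of `τ`. -/
noncomputable def AttentionFunction.reindex {L : Finset LAB} (α : AttentionFunction L)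
    (τ : ℕ → ℕ) : AttentionFunction L where
  toFun G := (α.toFun G).reindex τ
  iso_invariant G H e i u := by
    have h : ∀ j, (α.toFun G).lbl j u = (α.toFun H).lbl j (e.toEquiv u) :=
      fun j => α.iso_invariant G H e j u
    simp only [RunSkeleton.reindex, RunSkeleton.total, Option.some.injEq, decide_eq_decide, h]

/-- Every assignment of colors can be replaced by a similar one. -/
theorem ColorSimilarity.exists_similar {A A' : Type*} (σ : ColorSimilarity A A') {S : Type}
    (f : S → A) :
    ∃ f' : S → A', ∀ s, ∃ P : σ.cells, f s ∈ (P : Set A) ∧ f' s ∈ (σ.p P : Set A') := by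
  have h : ∀ s, ∃ a' : A', ∃ P : σ.cells, f s ∈ (P : Set A) ∧ a' ∈ (σ.p P : Set A') := by
    intro s
    obtain ⟨P, ⟨hP, hs⟩, -⟩ := σ.isPartition.2 (f s)
    -- Cells of a partition are nonempty, so the partner of the cell of `f s` supplies a color.
    obtain ⟨a', ha'⟩ := Setoid.nonempty_of_mem_partition σ.isPartition' (σ.p ⟨P, hP⟩).2
    exact ⟨a', ⟨P, hP⟩, hs, ha'⟩
  exact ⟨fun s => (h s).choose, fun s => (h s).choose_spec⟩

/-- The inverse of a color similarity. -/
def ColorSimilarity.symm {A A' : Type*} (σ : ColorSimilarity A A') : ColorSimilarity A' A where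
  cells := σ.cells'
  cells' := σ.cells
  isPartition := σ.isPartition'
  isPartition' := σ.isPartition
  p := σ.p.symm

theorem ColorSimilarity.rel_of_symm {A A' : Type*} {σ : ColorSimilarity A A'} {S S' : Type}
    {f : S → A} {f' : S' → A'} {s : S} {s' : S'} (h : σ.symm.Rel f' f s' s) : σ.Rel f f' s s' := by
  obtain ⟨P, h1, h2⟩ := h
  refine ⟨σ.p.symm P, h2, ?_⟩
  exact (congrArg (fun Q : σ.cells' => f' s' ∈ (Q : Set A')) (σ.p.apply_symm_apply P)).mpr h1

theorem RunSimilar.of_symm {A A' : Type*} {σ : ColorSimilarity A A'} {S S' : Type} {ρ : PaRun S A}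
    {ρ' : PaRun S' A'} (h : RunSimilar σ.symm ρ' ρ) : RunSimilar σ ρ ρ' := by
  obtain ⟨g, hv, hr, hα⟩ := h
  refine ⟨g.symm, by rw [← hv, Equiv.symm_apply_apply], fun i u => ?_, fun i u => ?_⟩
  · have := hr i (g.symm u)
    rw [Equiv.apply_symm_apply] at this
    revert this
    generalize ρ'.r.lbl i (g.symm u) = a
    generalize ρ.r.lbl i u = b
    intro this
    cases this with
    | some h => exact .some (ColorSimilarity.rel_of_symm h)
    | none => exact .none
  · rw [hα, Equiv.apply_symm_apply]

theorem PaRunClassification.EquivalentWrt.symm {S S' : Type} {A A' T : Type*}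
    {σ : ColorSimilarity A A'} {C : PaRunClassification S A T} {C' : PaRunClassification S' A' T}
    (h : C.EquivalentWrt σ C') : C'.EquivalentWrt σ.symm C :=
  fun _ _ hρ => (h _ _ hρ.of_symm).symm

/-- Every trace in `𝒳` is simulated by a trace in `𝒳'`. -/
def TracesSimulatedBy {L : Finset LAB} {ι ι' : Type} {S : ι → Type} {S' : ι' → Type}
    (𝒳 : ∀ i, Set (Trace L (S i))) (𝒳' : ∀ i, Set (Trace L (S' i))) : Prop :=
  ∀ i, ∀ X ∈ 𝒳 i, ∃ j, ∃ X' ∈ 𝒳' j, X.SimulatedBy X'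

theorem TracesSimulatedBy.trans {L : Finset LAB} {ι ι' ι'' : Type} {S : ι → Type} {S' : ι' → Type}
    {S'' : ι'' → Type} {𝒳 : ∀ i, Set (Trace L (S i))} {𝒳' : ∀ i, Set (Trace L (S' i))}
    {𝒳'' : ∀ i, Set (Trace L (S'' i))} (h : TracesSimulatedBy 𝒳 𝒳')
    (h' : TracesSimulatedBy 𝒳' 𝒳'') : TracesSimulatedBy 𝒳 𝒳'' := by
  intro i X hX
  obtain ⟨j, X', hX', hs⟩ := h i X hX
  obtain ⟨k, X'', hX'', hs'⟩ := h' j X' hX'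
  exact ⟨k, X'', hX'', hs.trans hs'⟩

/-- The original run and the simulating run are compared through a third one: the simulating run
restricted to the rounds `τ t`, with the original attention. Equivalence of the classifiers handles
the first comparison, and attention-invariance of `C'` handles the second. -/
theorem exists_equivalent_of_simulatedBy {L : Finset LAB} {A A' T : Type*}
    {σ : ColorSimilarity A A'} {ℛ : PreClassificationSystem L A} {ℛ' : PreClassificationSystem L A'}
    {𝒳 : ∀ i, Set (Trace L (ℛ.Label i))} {𝒳' : ∀ i, Set (Trace L (ℛ'.Label i))}
    (h𝒳 : ℛ.HasTraces 𝒳) (h𝒳' : ℛ'.HasTraces 𝒳') (hsim : TracesSimulatedBy 𝒳 𝒳')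
    {C : ℛ.Classifier T} {C' : ℛ'.Classifier T} (hC' : ∀ j, (C' j).AttentionInvariant)
    (heq : ∀ i j, (C i).EquivalentWrt σ (C' j)) :
    ∀ K ∈ ℛ.uniform C, ∃ K' ∈ ℛ'.uniform C', K.Equivalent K' := by
  rintro K ⟨i, R, hR, rfl⟩
  obtain ⟨X, hX, hRX⟩ := h𝒳.exists_trace i R hR
  obtain ⟨j, X', hX', dec, τ, hτ, hdec⟩ := hsim i X hX
  -- A label of the simulating device is colored like its decoding, up to passing to the
  -- corresponding cell.
  obtain ⟨f', hf'⟩ := σ.exists_similar (R.f ∘ dec)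
  obtain ⟨R', hR', rfl, hα, hRX'⟩ := h𝒳'.exists_gen j X' hX' (R.α.reindex τ) f'
  refine ⟨_, ⟨j, R', hR', rfl⟩, fun G v => ?_⟩
  -- This run need not be generated by any member of `ℛ'`; classifications are defined on all
  -- pa-runs, so it can still serve as the intermediate run.
  let ρ : PaRun (ℛ'.Label j) A' :=
    { V := G.V
      r := RunSkeleton.total fun t => X' G (τ t)
      f := R'.f
      α := R.α.toFun G
      v := v }
  have h1 : (C i).toFun (R.paRun G v) = (C' j).toFun ρ := by
    refine heq i j _ _ ⟨Equiv.refl _, rfl, fun t u => ?_, fun t u => rfl⟩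
    simp only [AttentionRunGenerator.paRun, hRX, RunSkeleton.total, ρ]
    refine .some ?_
    obtain ⟨P, hP, hP'⟩ := hf' (X' G (τ t) u)
    refine ⟨P, ?_, hP'⟩
    exact (congrArg (fun s => R.f s ∈ (P : Set A)) (hdec G t u)).mp hP
  have h2 : (C' j).toFun (R'.paRun G v) = (C' j).toFun ρ := by
    refine hC' j _ _ ⟨rfl, Equiv.refl _, rfl, fun k u => ?_⟩
    have := RunSkeleton.process_reindex ρ.r (R'.r G) (R.α.toFun G) hτ
      (fun t u => by rw [hRX']; rfl) k u
    simp only [PaRun.process, AttentionRunGenerator.paRun, hα]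
    exact this
  exact h1.trans h2.symm

/-- The converse inclusion is the same transfer for the inverse color similarity. -/
theorem sameExpressivePowerWrt_of_simulatedBy {L : Finset LAB} {A A' T : Type*}
    (σ : ColorSimilarity A A') {ℛ : PreClassificationSystem L A}
    {ℛ' : PreClassificationSystem L A'} {𝒳 : ∀ i, Set (Trace L (ℛ.Label i))}
    {𝒳' : ∀ i, Set (Trace L (ℛ'.Label i))} (h𝒳 : ℛ.HasTraces 𝒳) (h𝒳' : ℛ'.HasTraces 𝒳')
    (h : TracesSimulatedBy 𝒳 𝒳') (h' : TracesSimulatedBy 𝒳' 𝒳) :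
    SameExpressivePowerWrt T σ ℛ ℛ' := fun _ _ hC hC' heq =>
  ⟨exists_equivalent_of_simulatedBy h𝒳 h𝒳' h hC' heq,
    exists_equivalent_of_simulatedBy h𝒳' h𝒳 h' hC fun j i => (heq i j).symm⟩

/-- The traces of GNN[F]s. -/
def gnnfTraces (L : Finset LAB) (i : FloatSystem × ℕ+) : Set (Trace L (i.1.Vec i.2)) :=
  Set.range GNNF.state

/-- The traces of R-simple GNN[F]s. -/
def rSimpleGNNFTraces (L : Finset LAB) (i : FloatSystem × ℕ+) : Set (Trace L (i.1.Vec i.2)) :=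
  GNNF.state '' {N | N.IsRSimple}

/-- The traces of GNN[F]s with global readout. -/
def gnnfgTraces (L : Finset LAB) (i : FloatSystem × ℕ+) : Set (Trace L (i.1.Vec i.2)) :=
  Set.range GNNFG.state

/-- The traces of R-simple GNN[F]s with global readout. -/
def rSimpleGNNFGTraces (L : Finset LAB) (i : FloatSystem × ℕ+) : Set (Trace L (i.1.Vec i.2)) :=
  GNNFG.state '' {N | N.IsRSimple}

/-- The trace of a program. -/
def GMSCProgram.trace {g : Bool} {L : Finset LAB} {𝒯 : Finset VAR} (Λ : GMSCProgram g L 𝒯) :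
    Trace L (Set 𝒯) := fun G i u => {X | Schema.Sat G u (Λ.iter i X)}

/-- The traces of programs. -/
def gmscTraces (g : Bool) (L : Finset LAB) (𝒯 : Finset VAR) : Set (Trace L (Set 𝒯)) :=
  Set.range (GMSCProgram.trace (g := g))

/-! ### The model classes described by their traces -/

theorem hasTraces_GNNA (L : Finset LAB) (B : Type*) : (GNNA L B).HasTraces (gnnfTraces L) where
  exists_trace := by
    rintro i _ ⟨N, att, f, rfl⟩
    exact ⟨_, ⟨N, rfl⟩, fun G => rfl⟩
  exists_gen := by
    rintro i _ ⟨N, rfl⟩ att f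
    exact ⟨_, ⟨N, att, f, rfl⟩, rfl, rfl, fun G => rfl⟩

theorem hasTraces_RSimpleGNNA (L : Finset LAB) (B : Type*) :
    (RSimpleGNNA L B).HasTraces (rSimpleGNNFTraces L) where
  exists_trace := by
    rintro i _ ⟨N, att, f, h, rfl⟩
    exact ⟨_, ⟨N, h, rfl⟩, fun G => rfl⟩
  exists_gen := by
    rintro i _ ⟨N, h, rfl⟩ att f
    exact ⟨_, ⟨N, att, f, h, rfl⟩, rfl, rfl, fun G => rfl⟩

theorem hasTraces_GNNAG (L : Finset LAB) (B : Type*) : (GNNAG L B).HasTraces (gnnfgTraces L) where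
  exists_trace := by
    rintro i _ ⟨N, att, f, rfl⟩
    exact ⟨_, ⟨N, rfl⟩, fun G => rfl⟩
  exists_gen := by
    rintro i _ ⟨N, rfl⟩ att f
    exact ⟨_, ⟨N, att, f, rfl⟩, rfl, rfl, fun G => rfl⟩

theorem hasTraces_RSimpleGNNAG (L : Finset LAB) (B : Type*) :
    (RSimpleGNNAG L B).HasTraces (rSimpleGNNFGTraces L) where
  exists_trace := by
    rintro i _ ⟨N, att, f, h, rfl⟩
    exact ⟨_, ⟨N, h, rfl⟩, fun G => rfl⟩
  exists_gen := by
    rintro i _ ⟨N, h, rfl⟩ att f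
    exact ⟨_, ⟨N, att, f, h, rfl⟩, rfl, rfl, fun G => rfl⟩

theorem hasTraces_GMSC (g : Bool) (L : Finset LAB) (B : Type*) :
    (GMSC g L B).HasTraces (gmscTraces g L) where
  exists_trace := by
    rintro i _ ⟨Λ, att, f, rfl⟩
    exact ⟨_, ⟨Λ, rfl⟩, fun G => rfl⟩
  exists_gen := by
    rintro i _ ⟨Λ, rfl⟩ att f
    exact ⟨_, ⟨Λ, att, f, rfl⟩, rfl, rfl, fun G => rfl⟩

theorem rSimpleGNNFTraces_simulatedBy_gnnfTraces (L : Finset LAB) :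
    TracesSimulatedBy (rSimpleGNNFTraces L) (gnnfTraces L) := by
  rintro i _ ⟨N, -, rfl⟩
  exact ⟨i, _, ⟨N, rfl⟩, .refl _⟩

theorem rSimpleGNNFGTraces_simulatedBy_gnnfgTraces (L : Finset LAB) :
    TracesSimulatedBy (rSimpleGNNFGTraces L) (gnnfgTraces L) := by
  rintro i _ ⟨N, -, rfl⟩
  exact ⟨i, _, ⟨N, rfl⟩, .refl _⟩

/-- Classes of run-generators whose traces simulate each other cyclically have the same expressive
power. -/
theorem sameExpressivePowerWrt_of_cycle {L : Finset LAB} {B B' T : Type*}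
    (σ : ColorSimilarity B B') {ℛ₁ : PreClassificationSystem L B}
    {ℛ₂ : PreClassificationSystem L B} {ℛ₂' ℛ₃ : PreClassificationSystem L B'}
    {𝒳₁ : ∀ i, Set (Trace L (ℛ₁.Label i))} {𝒳₂ : ∀ i, Set (Trace L (ℛ₂.Label i))}
    {𝒳₂' : ∀ i, Set (Trace L (ℛ₂'.Label i))} {𝒳₃ : ∀ i, Set (Trace L (ℛ₃.Label i))}
    (h₁ : ℛ₁.HasTraces 𝒳₁) (h₂ : ℛ₂.HasTraces 𝒳₂) (h₂' : ℛ₂'.HasTraces 𝒳₂')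
    (h₃ : ℛ₃.HasTraces 𝒳₃) (h₂₁ : TracesSimulatedBy 𝒳₂ 𝒳₁) (h₂₁' : TracesSimulatedBy 𝒳₂' 𝒳₁)
    (h₁₃ : TracesSimulatedBy 𝒳₁ 𝒳₃) (h₃₂ : TracesSimulatedBy 𝒳₃ 𝒳₂)
    (h₃₂' : TracesSimulatedBy 𝒳₃ 𝒳₂') :
    SameExpressivePowerWrt T σ ℛ₁ ℛ₂' ∧ SameExpressivePowerWrt T σ ℛ₁ ℛ₃ ∧
      SameExpressivePowerWrt T σ ℛ₂ ℛ₃ :=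
  ⟨sameExpressivePowerWrt_of_simulatedBy σ h₁ h₂' (h₁₃.trans h₃₂') h₂₁',
    sameExpressivePowerWrt_of_simulatedBy σ h₁ h₃ h₁₃ (h₃₂.trans h₂₁),
    sameExpressivePowerWrt_of_simulatedBy σ h₂ h₃ (h₂₁.trans h₁₃) h₃₂⟩

/-! ### Semantics of schemata -/

/-- Truth of a schema under an interpretation of the schema variables. -/
def Schema.Eval {g : Bool} {L : Finset LAB} {X : Type} (G : LGraph L) (I : X → G.V → Prop) :
    G.V → Schema g L X → Prop
  | _, top => True
  | v, symb p => p ∈ G.lab v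
  | v, var x => I x v
  | v, neg φ => ¬ Eval G I v φ
  | v, and φ ψ => Eval G I v φ ∧ Eval G I v ψ
  | v, dia k φ => k ≤ {u | G.E v u ∧ Eval G I u φ}.ncard
  | _, gdia _ k φ => k ≤ {u | Eval G I u φ}.ncard

/-- This turns the syntactic iteration of a program into an update of truth values, so that both
simulations can be proved by induction on the round. -/
theorem Schema.sat_subst {g : Bool} {L : Finset LAB} {X : Type} (G : LGraph L)
    (s : X → Formula g L) (φ : Schema g L X) :
    ∀ v, Schema.Sat G v (φ.subst s) ↔ φ.Eval G (fun x u => Schema.Sat G u (s x)) v := by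
  induction φ with
  | top => intro v; simp [Schema.subst, Schema.Sat, Schema.Eval]
  | symb p => intro v; simp [Schema.subst, Schema.Sat, Schema.Eval]
  | var x => intro v; simp [Schema.subst, Schema.Eval]
  | neg φ ih => intro v; simp [Schema.subst, Schema.Sat, Schema.Eval, ih]
  | and φ ψ ih ih' => intro v; simp [Schema.subst, Schema.Sat, Schema.Eval, ih, ih']
  | dia k φ ih => intro v; simp [Schema.subst, Schema.Sat, Schema.Eval, ih]
  | gdia h k φ ih => intro v; simp [Schema.subst, Schema.Sat, Schema.Eval, ih]

theorem Schema.sat_iff_eval {g : Bool} {L : Finset LAB} (G : LGraph L)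
    (I : Empty → G.V → Prop) (φ : Formula g L) :
    ∀ v, Schema.Sat G v φ ↔ φ.Eval G I v := by
  induction φ with
  | top => intro v; simp [Schema.Sat, Schema.Eval]
  | symb p => intro v; simp [Schema.Sat, Schema.Eval]
  | var x => exact x.elim
  | neg φ ih => intro v; simp [Schema.Sat, Schema.Eval, ih]
  | and φ ψ ih ih' => intro v; simp [Schema.Sat, Schema.Eval, ih, ih']
  | dia k φ ih => intro v; simp [Schema.Sat, Schema.Eval, ih]
  | gdia h k φ ih => intro v; simp [Schema.Sat, Schema.Eval, ih]

/-- Renaming of schema variables. -/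
def Schema.rename {g : Bool} {P X Y : Type} (f : X → Y) : Schema g P X → Schema g P Y
  | top => top
  | symb p => symb p
  | var x => var (f x)
  | neg φ => neg (φ.rename f)
  | and φ ψ => and (φ.rename f) (ψ.rename f)
  | dia k φ => dia k (φ.rename f)
  | gdia h k φ => gdia h k (φ.rename f)

theorem Schema.eval_rename {g : Bool} {L : Finset LAB} {X Y : Type} (G : LGraph L) (f : X → Y)
    (I : Y → G.V → Prop) (φ : Schema g L X) :
    ∀ v, (φ.rename f).Eval G I v ↔ φ.Eval G (fun x => I (f x)) v := by
  induction φ with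
  | top => intro v; simp [Schema.rename, Schema.Eval]
  | symb p => intro v; simp [Schema.rename, Schema.Eval]
  | var x => intro v; simp [Schema.rename, Schema.Eval]
  | neg φ ih => intro v; simp [Schema.rename, Schema.Eval, ih]
  | and φ ψ ih ih' => intro v; simp [Schema.rename, Schema.Eval, ih, ih']
  | dia k φ ih => intro v; simp [Schema.rename, Schema.Eval, ih]
  | gdia h k φ ih => intro v; simp [Schema.rename, Schema.Eval, ih]

/-- Finite conjunctions. -/
noncomputable def Schema.bigAnd {g : Bool} {P X ι : Type} [Finite ι] (φ : ι → Schema g P X) :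
    Schema g P X :=
  ((Set.toFinite (Set.univ : Set ι)).toFinset.toList.map φ).foldr Schema.and Schema.top

theorem Schema.eval_bigAnd {g : Bool} {L : Finset LAB} {X ι : Type} [Finite ι] (G : LGraph L)
    (I : X → G.V → Prop) (φ : ι → Schema g L X) (v : G.V) :
    (Schema.bigAnd φ).Eval G I v ↔ ∀ i, (φ i).Eval G I v := by
  have key : ∀ l : List ι, Schema.Eval G I v ((l.map φ).foldr Schema.and Schema.top) ↔
      ∀ i ∈ l, (φ i).Eval G I v := by
    intro l
    induction l with
    | nil => simp [Schema.Eval]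
    | cons a l ih => simp [Schema.Eval, ih]
  rw [Schema.bigAnd, key]
  simp

/-- Finite disjunctions. -/
noncomputable def Schema.bigOr {g : Bool} {P X ι : Type} [Finite ι] (φ : ι → Schema g P X) :
    Schema g P X :=
  (Schema.bigAnd fun i => (φ i).neg).neg

theorem Schema.eval_bigOr {g : Bool} {L : Finset LAB} {X ι : Type} [Finite ι] (G : LGraph L)
    (I : X → G.V → Prop) (φ : ι → Schema g L X) (v : G.V) :
    (Schema.bigOr φ).Eval G I v ↔ ∃ i, (φ i).Eval G I v := by
  simp [Schema.bigOr, Schema.Eval, Schema.eval_bigAnd]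

/-! ### Counting message passing automata -/

/-- Finite automata that update the state of a node by its state and the multisets of the states of
its out-neighbours and of all nodes, in which multiplicities are only counted up to a bound; the
second multiset is only available if `g = true`. -/
structure CountingAutomaton (g : Bool) (L : Finset LAB) (Q : Type) where
  init : Set L → Q
  step : Q → Multiset Q → Multiset Q → Q
  bound : ℕ
  step_kProj : ∀ q M N, step q M N = step q (kProj bound M) (kProj bound N)
  step_global : g = false → ∀ q M N₁ N₂, step q M N₁ = step q M N₂

/-- The state of a node in a round. -/
noncomputable def CountingAutomaton.state {g : Bool} {L : Finset LAB} {Q : Type}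
    (𝒜 : CountingAutomaton g L Q) : Trace L Q
  | G, 0, v => 𝒜.init (G.lab v)
  | G, t + 1, v => 𝒜.step (𝒜.state G t v) (G.outMultiset (𝒜.state G t) v)
      (G.allMultiset (𝒜.state G t))

/-! ### GNN[F]s as counting automata -/

open Classical in
theorem kProj_kProj_of_le {Q : Type} {k m : ℕ} (h : k ≤ m) (M : Multiset Q) :
    kProj k (kProj m M) = kProj k M := by
  ext x
  simp only [count_kProj]
  omega

/-- Bounds can be raised, which gives `agg` and `read` a common one. -/
theorem IsBounded.eq_kProj_of_le {Q Q' : Type} {F : Multiset Q → Q'} {k m : ℕ}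
    (h : ∀ M, F M = F (kProj k M)) (hm : k ≤ m) (M : Multiset Q) : F M = F (kProj m M) := by
  rw [h, h (kProj m M), kProj_kProj_of_le hm]

/-- A GNN[F] as a counting automaton. -/
noncomputable def GNNF.automaton {L : Finset LAB} {F : FloatSystem} {d : ℕ+} (N : GNNF L F d) :
    CountingAutomaton false L (F.Vec d) where
  init := N.init
  step q M _ := N.com q (N.agg M)
  bound := N.bounded.choose
  step_kProj q M _ := by rw [N.bounded.choose_spec M]
  step_global _ _ _ _ _ := rfl

theorem GNNF.state_automaton {L : Finset LAB} {F : FloatSystem} {d : ℕ+} (N : GNNF L F d)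
    (G : LGraph L) (t : ℕ) : N.automaton.state G t = N.state G t := by
  induction t with
  | zero => rfl
  | succ t ih =>
    funext v
    simp only [CountingAutomaton.state, ih]
    rfl

/-- A GNN[F] with global readout as a counting automaton. -/
noncomputable def GNNFG.automaton {L : Finset LAB} {F : FloatSystem} {d : ℕ+} (N : GNNFG L F d) :
    CountingAutomaton true L (F.Vec d) where
  init := N.init
  step q M M' := N.com q (N.agg M) (N.read M')
  bound := max N.bounded.choose N.bounded_read.choose
  step_kProj q M M' := by
    rw [← IsBounded.eq_kProj_of_le N.bounded.choose_spec (le_max_left _ _),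
      ← IsBounded.eq_kProj_of_le N.bounded_read.choose_spec (le_max_right _ _)]
  step_global h := by simp at h

theorem GNNFG.state_automaton {L : Finset LAB} {F : FloatSystem} {d : ℕ+} (N : GNNFG L F d)
    (G : LGraph L) (t : ℕ) : N.automaton.state G t = N.state G t := by
  induction t with
  | zero => rfl
  | succ t ih =>
    funext v
    simp only [CountingAutomaton.state, ih]
    rfl

/-! ### Counting automata as programs -/

open Classical in
theorem count_map_toFinset {V Q : Type} {s : Set V} (hs : s.Finite) (x : V → Q) (q : Q) :
    (hs.toFinset.val.map x).count q = {u | u ∈ s ∧ x u = q}.ncard := by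
  have h : {u | u ∈ s ∧ x u = q} = (hs.toFinset.filter fun u => q = x u : Finset V) := by
    ext u
    simp [eq_comm]
  rw [Multiset.count_map, h, Set.ncard_coe_finset]
  rfl

/-- The multiset with the given multiplicities. -/
noncomputable def multisetOfCounts {Q : Type} [Finite Q] (c : Q → ℕ) : Multiset Q :=
  (Set.toFinite (Set.univ : Set Q)).toFinset.sum fun q => c q • {q}

open Classical in
theorem count_multisetOfCounts {Q : Type} [Finite Q] (c : Q → ℕ) (q : Q) :
    (multisetOfCounts c).count q = c q := by
  rw [multisetOfCounts, Multiset.count_sum', Finset.sum_eq_single q]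
  · simp
  · intro b _ hb
    simp [Ne.symm hb]
  · simp

open Classical in
-- Truncated multisets over a finite set are coded by their bounded counts. This leaves finitely
-- many profiles and lets each be tested state by state.
theorem kProj_eq_multisetOfCounts {Q : Type} [Finite Q] {k : ℕ} (M : Multiset Q) (c : Q → ℕ) :
    kProj k M = multisetOfCounts c ↔ ∀ q, min (M.count q) k = c q := by
  rw [Multiset.ext]
  simp only [count_kProj, count_multisetOfCounts]

/-- `φ` holds at `m` out-neighbours, where `m` is only counted up to `k`. -/
def Schema.diaExactly {g : Bool} {P X : Type} (k m : ℕ) (φ : Schema g P X) : Schema g P X :=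
  if m < k then (dia m φ).and (dia (m + 1) φ).neg else dia m φ

/-- Below the bound the count must be exactly `m`; at `m = k` truncation hides any excess and a
lower bound suffices. For `m > k` the equivalence would fail, as truncated counts never exceed `k`.
-/
theorem Schema.eval_diaExactly {g : Bool} {L : Finset LAB} {X : Type} (G : LGraph L)
    (I : X → G.V → Prop) {k m : ℕ} (hm : m ≤ k) (φ : Schema g L X) (v : G.V) :
    (φ.diaExactly k m).Eval G I v ↔ min {u | G.E v u ∧ φ.Eval G I u}.ncard k = m := by
  unfold Schema.diaExactly
  split_ifs with h <;> simp only [Schema.Eval] <;> omega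

/-- `φ` holds at `m` nodes, where `m` is only counted up to `k`. -/
def Schema.gdiaExactly {g : Bool} {P X : Type} (hg : g = true) (k m : ℕ) (φ : Schema g P X) :
    Schema g P X :=
  if m < k then (gdia hg m φ).and (gdia hg (m + 1) φ).neg else gdia hg m φ

theorem Schema.eval_gdiaExactly {g : Bool} {L : Finset LAB} {X : Type} (G : LGraph L)
    (I : X → G.V → Prop) (hg : g = true) {k m : ℕ} (hm : m ≤ k) (φ : Schema g L X) (v : G.V) :
    (φ.gdiaExactly hg k m).Eval G I v ↔ min {u | φ.Eval G I u}.ncard k = m := by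
  unfold Schema.gdiaExactly
  split_ifs with h <;> simp only [Schema.Eval] <;> omega

open Classical in
/-- The node is labeled with precisely the symbols in `P`. -/
noncomputable def Schema.labelIs {g : Bool} {L : Finset LAB} {X : Type} (P : Set L) :
    Schema g L X :=
  bigAnd fun p : L => if p ∈ P then symb p else (symb p).neg

theorem Schema.eval_labelIs {g : Bool} {L : Finset LAB} {X : Type} (G : LGraph L)
    (I : X → G.V → Prop) (P : Set L) (v : G.V) :
    (Schema.labelIs P : Schema g L X).Eval G I v ↔ G.lab v = P := by
  rw [Schema.labelIs, Schema.eval_bigAnd, Set.ext_iff]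
  refine forall_congr' fun p => ?_
  split_ifs with h <;> simp [Schema.Eval, h]

/-- The profiles of states and bounded multisets that lead to the state `q`. -/
def CountingAutomaton.Transition {g : Bool} {L : Finset LAB} {Q : Type} [Finite Q]
    (𝒜 : CountingAutomaton g L Q) (q : Q) : Type :=
  {x : Q × (Q → Fin (𝒜.bound + 1)) × (Q → Fin (𝒜.bound + 1)) //
    𝒜.step x.1 (multisetOfCounts fun a => x.2.1 a) (multisetOfCounts fun a => x.2.2 a) = q}

instance {g : Bool} {L : Finset LAB} {Q : Type} [Finite Q] (𝒜 : CountingAutomaton g L Q) (q : Q) :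
    Finite (𝒜.Transition q) := inferInstanceAs (Finite {_x // _})

/-- The formula that describes the applicability of a transition. -/
noncomputable def CountingAutomaton.transitionSchema {g : Bool} {L : Finset LAB} {Q X : Type}
    [Finite Q] (𝒜 : CountingAutomaton g L Q) (e : Q → X) {q : Q} (x : 𝒜.Transition q) :
    Schema g L X :=
  (Schema.var (e x.1.1)).and
    ((Schema.bigAnd fun a => (Schema.var (e a)).diaExactly 𝒜.bound (x.1.2.1 a)).and
      (if hg : g = true then
        Schema.bigAnd fun a => (Schema.var (e a)).gdiaExactly hg 𝒜.bound (x.1.2.2 a)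
      else Schema.top))

open Classical in
theorem CountingAutomaton.eval_transitionSchema {g : Bool} {L : Finset LAB} {Q X : Type}
    [Finite Q] (𝒜 : CountingAutomaton g L Q) (e : Q → X) (G : LGraph L) (I : X → G.V → Prop)
    (t : ℕ) (hI : ∀ a u, I (e a) u ↔ 𝒜.state G t u = a) {q : Q} (x : 𝒜.Transition q) (v : G.V) :
    (𝒜.transitionSchema e x).Eval G I v ↔ 𝒜.state G t v = x.1.1 ∧
      kProj 𝒜.bound (G.outMultiset (𝒜.state G t) v) = multisetOfCounts (fun a => x.1.2.1 a) ∧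
      (g = true →
        kProj 𝒜.bound (G.allMultiset (𝒜.state G t)) = multisetOfCounts (fun a => x.1.2.2 a)) := by
  have h1 : ∀ a, (G.outMultiset (𝒜.state G t) v).count a =
      {u | G.E v u ∧ 𝒜.state G t u = a}.ncard := fun a =>
    count_map_toFinset (Set.toFinite {u | G.E v u}) (𝒜.state G t) a
  have h2 : ∀ a, (G.allMultiset (𝒜.state G t)).count a = {u | 𝒜.state G t u = a}.ncard :=
    fun a => by
    rw [LGraph.allMultiset, count_map_toFinset]
    simp
  rw [kProj_eq_multisetOfCounts, kProj_eq_multisetOfCounts, CountingAutomaton.transitionSchema]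
  simp only [Schema.Eval, Schema.eval_bigAnd, hI, h1, h2]
  refine and_congr_right' (and_congr (forall_congr' fun a => ?_) ?_)
  · rw [Schema.eval_diaExactly _ _ (Nat.lt_succ_iff.1 (x.1.2.1 a).2)]
    simp only [Schema.Eval, hI]
  · split_ifs with hg
    · simp only [hg, forall_true_left, Schema.eval_bigAnd]
      refine forall_congr' fun a => ?_
      rw [Schema.eval_gdiaExactly _ _ hg (Nat.lt_succ_iff.1 (x.1.2.2 a).2)]
      simp only [Schema.Eval, hI]
    · simp [hg, Schema.Eval]

/-- Each state becomes a head predicate meaning "the current state is `q`". Its terminal body lists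
the label sets initialized to `q`, its iteration body the profiles leading to `q`. There is no
slowdown: `τ` is the identity. -/
theorem CountingAutomaton.exists_program {g : Bool} {L : Finset LAB} {Q : Type} [Finite Q]
    (𝒜 : CountingAutomaton g L Q) :
    ∃ (𝒯 : Finset VAR) (Λ : GMSCProgram g L 𝒯), 𝒜.state.SimulatedBy Λ.trace := by
  classical
  obtain ⟨n, ⟨e₀⟩⟩ := Finite.exists_equiv_fin Q
  let 𝒯 : Finset VAR := Finset.range n
  let e : Q ≃ 𝒯 := e₀.trans (Fintype.equivOfCardEq (by simp [𝒯]))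
  let Λ : GMSCProgram g L 𝒯 :=
    { terminal := fun X => Schema.bigOr fun P : {P : Set L // 𝒜.init P = e.symm X} =>
        Schema.labelIs P.1
      iteration := fun X => Schema.bigOr fun x : 𝒜.Transition (e.symm X) =>
        𝒜.transitionSchema e x }
  have key : ∀ G t q v, Schema.Sat G v (Λ.iter t (e q)) ↔ 𝒜.state G t v = q := by
    intro G t
    induction t with
    | zero =>
      intro q v
      rw [GMSCProgram.iter, Schema.sat_iff_eval G (fun x => x.elim), Schema.eval_bigOr]
      simp [Schema.eval_labelIs, CountingAutomaton.state]
    | succ t ih =>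
      intro q v
      rw [GMSCProgram.iter, Schema.sat_subst, Schema.eval_bigOr]
      simp only [𝒜.eval_transitionSchema e G (fun x u => Schema.Sat G u (Λ.iter t x)) t ih]
      have hstep : 𝒜.state G (t + 1) v = 𝒜.step (𝒜.state G t v)
          (kProj 𝒜.bound (G.outMultiset (𝒜.state G t) v))
          (kProj 𝒜.bound (G.allMultiset (𝒜.state G t))) := by
        rw [← 𝒜.step_kProj]
        rfl
      rw [hstep]
      have hc : ∀ M : Multiset Q, ∃ c : Q → Fin (𝒜.bound + 1),
          kProj 𝒜.bound M = multisetOfCounts fun a => c a := fun M =>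
        ⟨fun a => ⟨min (M.count a) 𝒜.bound, by omega⟩, by
          rw [kProj_eq_multisetOfCounts]; intro q; congr! 1⟩
      constructor
      · rintro ⟨x, h1, h2, h3⟩
        have hx := x.2.trans (e.symm_apply_apply q)
        rw [← h2, ← h1] at hx
        cases g
        -- Without globality the third entry of the profile is not tested by the schema, but the
        -- step does not depend on it either.
        · rw [𝒜.step_global rfl _ _ _ _]
          exact hx
        · rw [h3 rfl]
          exact hx
      · intro h
        obtain ⟨c, hc1⟩ := hc (G.outMultiset (𝒜.state G t) v)
        obtain ⟨c', hc2⟩ := hc (G.allMultiset (𝒜.state G t))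
        exact ⟨⟨(𝒜.state G t v, c, c'), by rw [← hc1, ← hc2, h, Equiv.symm_apply_apply]⟩,
          rfl, hc1, fun _ => hc2⟩
  -- Exactly one head predicate is true at a node, so the labels that occur are singletons, and
  -- decoding inverts `q ↦ {e q}`.
  have hinj : Function.Injective fun q : Q => ({e q} : Set 𝒯) := fun a b h => by
    simpa using h
  have : Nonempty Q := ⟨𝒜.init ∅⟩
  refine ⟨𝒯, Λ, Function.invFun fun q : Q => ({e q} : Set 𝒯), id, strictMono_id, fun G t v => ?_⟩
  have : Λ.trace G t v = {e (𝒜.state G t v)} := by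
    ext X
    obtain ⟨q, rfl⟩ := e.surjective X
    simp only [GMSCProgram.trace, Set.mem_ofPred_eq, key, Set.mem_singleton_iff,
      EmbeddingLike.apply_eq_iff_eq, eq_comm]
  rw [id, this]
  exact Function.leftInverse_invFun hinj _

theorem gnnfTraces_simulatedBy_gmscTraces (L : Finset LAB) :
    TracesSimulatedBy (gnnfTraces L) (gmscTraces false L) := by
  rintro i _ ⟨N, rfl⟩
  obtain ⟨𝒯, Λ, h⟩ := N.automaton.exists_program
  refine ⟨𝒯, _, ⟨Λ, rfl⟩, ?_⟩
  rwa [show N.automaton.state = N.state from funext fun G => funext fun t =>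
    N.state_automaton G t] at h

theorem gnnfgTraces_simulatedBy_gmscTraces (L : Finset LAB) :
    TracesSimulatedBy (gnnfgTraces L) (gmscTraces true L) := by
  rintro i _ ⟨N, rfl⟩
  obtain ⟨𝒯, Λ, h⟩ := N.automaton.exists_program
  refine ⟨𝒯, _, ⟨Λ, rfl⟩, ?_⟩
  rwa [show N.automaton.state = N.state from funext fun G => funext fun t =>
    N.state_automaton G t] at h

/-! ### Synchronous networks of gates -/

/-- Gates that compute a bit of a node from the bits `i : I` in the previous round. -/
inductive Gate (g : Bool) (I : Type) : Type
  | one : Gate g I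
  | not : I → Gate g I
  | and : I → I → Gate g I
  | dia : ℕ → I → Gate g I
  | gdia : g = true → ℕ → I → Gate g I

/-- The value computed by a gate. -/
def Gate.Holds {g : Bool} {L : Finset LAB} {I : Type} (G : LGraph L) (b : I → G.V → Prop) :
    Gate g I → G.V → Prop
  | one, _ => True
  | not i, v => ¬ b i v
  | and i j, v => b i v ∧ b j v
  | dia k i, v => k ≤ {u | G.E v u ∧ b i u}.ncard
  | gdia _ k i, _ => k ≤ {u | b i u}.ncard

/-- Networks of gates, one for each bit `i : I`. -/
structure GateNetwork (g : Bool) (L : Finset LAB) (I : Type) where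
  init : I → Set L → Prop
  gate : I → Gate g I

/-- The bits of the nodes in a round. -/
def GateNetwork.Bit {g : Bool} {L : Finset LAB} {I : Type} (W : GateNetwork g L I)
    (G : LGraph L) : ℕ → I → G.V → Prop
  | 0, i, v => W.init i (G.lab v)
  | t + 1, i, v => (W.gate i).Holds G (W.Bit G t) v

/-! ### Evaluation of substitution programs by networks -/

/-- The immediate subschemata. -/
def Schema.children {g : Bool} {P X : Type} : Schema g P X → Set (Schema g P X)
  | top => ∅
  | symb _ => ∅
  | var _ => ∅
  | neg φ => {φ}
  | and φ ψ => {φ, ψ}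
  | dia _ φ => {φ}
  | gdia _ _ φ => {φ}

/-- The nesting depth of connectives. -/
def Schema.depth {g : Bool} {P X : Type} : Schema g P X → ℕ
  | top => 0
  | symb _ => 0
  | var _ => 0
  | neg φ => φ.depth + 1
  | and φ ψ => max φ.depth ψ.depth + 1
  | dia _ φ => φ.depth + 1
  | gdia _ _ φ => φ.depth + 1

/-- Closure under subschemata. -/
def SubschemaClosed {g : Bool} {P X : Type} (S : Set (Schema g P X)) : Prop :=
  ∀ φ ∈ S, φ.children ⊆ S

theorem SubschemaClosed.insert {g : Bool} {P X : Type} {S : Set (Schema g P X)}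
    (hS : SubschemaClosed S) {φ : Schema g P X} (h : φ.children ⊆ S) :
    SubschemaClosed (insert φ S) := by
  rintro ψ (rfl | hψ)
  · exact h.trans (Set.subset_insert _ _)
  · exact (hS ψ hψ).trans (Set.subset_insert _ _)

theorem SubschemaClosed.union {g : Bool} {P X : Type} {S S' : Set (Schema g P X)}
    (hS : SubschemaClosed S) (hS' : SubschemaClosed S') : SubschemaClosed (S ∪ S') := by
  rintro ψ (hψ | hψ)
  · exact (hS ψ hψ).trans Set.subset_union_left
  · exact (hS' ψ hψ).trans Set.subset_union_right

theorem Schema.exists_closed {g : Bool} {P X : Type} (φ : Schema g P X) :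
    ∃ S : Set (Schema g P X), S.Finite ∧ SubschemaClosed S ∧ φ ∈ S := by
  have atom : ∀ φ : Schema g P X, φ.children = ∅ →
      ∃ S : Set (Schema g P X), S.Finite ∧ SubschemaClosed S ∧ φ ∈ S := fun φ h =>
    ⟨{φ}, Set.finite_singleton _, by rintro _ rfl; simp [h], rfl⟩
  have step : ∀ φ : Schema g P X, (∃ S : Set (Schema g P X), S.Finite ∧ SubschemaClosed S ∧
      φ.children ⊆ S) → ∃ S : Set (Schema g P X), S.Finite ∧ SubschemaClosed S ∧ φ ∈ S :=
    fun φ ⟨S, hf, hc, h⟩ => ⟨_, hf.insert φ, hc.insert h, Set.mem_insert _ _⟩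
  induction φ with
  | top => exact atom _ rfl
  | symb p => exact atom _ rfl
  | var x => exact atom _ rfl
  | neg φ ih =>
    obtain ⟨S, hf, hc, h⟩ := ih
    exact step _ ⟨S, hf, hc, by simpa [Schema.children] using h⟩
  | and φ ψ ih ih' =>
    obtain ⟨S, hf, hc, h⟩ := ih
    obtain ⟨S', hf', hc', h'⟩ := ih'
    exact step _ ⟨S ∪ S', hf.union hf', hc.union hc', by
      rintro χ (rfl | rfl)
      · exact Or.inl h
      · exact Or.inr h'⟩
  | dia k φ ih =>
    obtain ⟨S, hf, hc, h⟩ := ih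
    exact step _ ⟨S, hf, hc, by simpa [Schema.children] using h⟩
  | gdia hg k φ ih =>
    obtain ⟨S, hf, hc, h⟩ := ih
    exact step _ ⟨S, hf, hc, by simpa [Schema.children] using h⟩

theorem exists_closed_of_family {g : Bool} {P X ι : Type} [Finite ι] (φ : ι → Schema g P X) :
    ∃ S : Set (Schema g P X), S.Finite ∧ SubschemaClosed S ∧ ∀ i, φ i ∈ S := by
  choose S hf hc h using fun i => (φ i).exists_closed
  refine ⟨⋃ i, S i, Set.finite_iUnion hf, fun ψ hψ => ?_, fun i => Set.mem_iUnion.2 ⟨i, h i⟩⟩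
  obtain ⟨i, hi⟩ := Set.mem_iUnion.1 hψ
  exact (hc i ψ hi).trans (Set.subset_iUnion S i)

/-- Truth values of head predicates: all are false in round `0`, and then the bodies `ψ` are
evaluated simultaneously. -/
def IteratedEval {g : Bool} {L : Finset LAB} {X : Type} (ψ : X → Schema g L X) (G : LGraph L) :
    ℕ → X → G.V → Prop
  | 0, _, _ => False
  | n + 1, x, v => (ψ x).Eval G (IteratedEval ψ G n) v

section
variable {g : Bool} {L : Finset LAB} {X : Type} {S : Set (Schema g L X)}

/-- The gate of the bit `(j, φ)`, where `j` counts the rounds modulo `K + 1`. -/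
def evalGate (hS : SubschemaClosed S) (ψ : X → Schema g L X) (hψ : ∀ x, ψ x ∈ S) (K : ℕ) :
    Fin (K + 1) → (φ : Schema g L X) → φ ∈ S → Gate g (Fin (K + 1) × S)
  | _, .top, _ => .one
  | j, .symb p, h => .and (j, ⟨.symb p, h⟩) (j, ⟨.symb p, h⟩)
  | j, .var x, h =>
    if j = 0 then .and (Fin.last K, ⟨ψ x, hψ x⟩) (Fin.last K, ⟨ψ x, hψ x⟩)
    else .and (j - 1, ⟨.var x, h⟩) (j - 1, ⟨.var x, h⟩)
  | j, .neg φ, h => .not (j - 1, ⟨φ, hS _ h (by simp [Schema.children])⟩)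
  | j, .and φ χ, h => .and (j - 1, ⟨φ, hS _ h (by simp [Schema.children])⟩)
      (j - 1, ⟨χ, hS _ h (by simp [Schema.children])⟩)
  | j, .dia k φ, h => .dia k (j - 1, ⟨φ, hS _ h (by simp [Schema.children])⟩)
  | j, .gdia hg k φ, h => .gdia hg k (j - 1, ⟨φ, hS _ h (by simp [Schema.children])⟩)

/-- The initial value of the bits for `φ`. -/
def evalInit : Schema g L X → Set L → Prop
  | .top, _ => True
  | .symb p, P => p ∈ P
  | _, _ => False

/-- The network that evaluates the bodies `ψ` again and again. -/
def evalNetwork (hS : SubschemaClosed S) (ψ : X → Schema g L X) (hψ : ∀ x, ψ x ∈ S) (K : ℕ) :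
    GateNetwork g L (Fin (K + 1) × S) where
  init i := evalInit i.2.1
  gate i := evalGate hS ψ hψ K i.1 i.2.1 i.2.2

/-- Bits for symbols copy themselves within the same phase `j` (conjunction of a bit with itself),
so they are correct in every round and every phase. -/
theorem bit_evalNetwork_symb (hS : SubschemaClosed S) (ψ : X → Schema g L X) (hψ : ∀ x, ψ x ∈ S)
    (K : ℕ) (G : LGraph L) (t : ℕ) (j : Fin (K + 1)) (p : L) (h : Schema.symb p ∈ S) (v : G.V) :
    (evalNetwork hS ψ hψ K).Bit G t (j, ⟨.symb p, h⟩) v ↔ p ∈ G.lab v := by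
  induction t with
  | zero => rfl
  | succ t ih => simp [GateNetwork.Bit, evalNetwork, evalGate, Gate.Holds] at ih ⊢; exact ih

theorem bit_evalNetwork_top (hS : SubschemaClosed S) (ψ : X → Schema g L X) (hψ : ∀ x, ψ x ∈ S)
    (K : ℕ) (G : LGraph L) (t : ℕ) (j : Fin (K + 1)) (h : Schema.top ∈ S) (v : G.V) :
    (evalNetwork hS ψ hψ K).Bit G t (j, ⟨.top, h⟩) v := by
  cases t <;> trivial

/-- Apart from the constant bits for `top` and symbols, a bit of phase `j` reads only bits of phase
`j - 1`. The network thus runs `K + 1` staggered evaluations that do not interact, and needs no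
clock: in round `n * (K + 1) + j` only phase `j` matters, and there all subschemata of depth at most
`j` have been settled with respect to iteration `n`. -/
theorem bit_evalNetwork (hS : SubschemaClosed S) (ψ : X → Schema g L X) (hψ : ∀ x, ψ x ∈ S)
    (K : ℕ) (hK : ∀ x, (ψ x).depth ≤ K) (G : LGraph L) (n : ℕ) :
    ∀ j (hj : j < K + 1) (φ : Schema g L X) (hφ : φ ∈ S) (v : G.V), φ.depth ≤ j →
      ((evalNetwork hS ψ hψ K).Bit G (n * (K + 1) + j) (⟨j, hj⟩, ⟨φ, hφ⟩) v ↔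
        φ.Eval G (IteratedEval ψ G n) v) := by
  -- Inner induction on the phase, for fixed `n`: if the variables are right at phase `0`, each
  -- further round settles one more level of depth.
  have zero : ∀ n, (∀ x (h : Schema.var x ∈ S) v,
      ((evalNetwork hS ψ hψ K).Bit G (n * (K + 1)) (0, ⟨.var x, h⟩) v ↔
        IteratedEval ψ G n x v)) →
      ∀ j (hj : j < K + 1) (φ : Schema g L X) (hφ : φ ∈ S) (v : G.V), φ.depth ≤ j →
      ((evalNetwork hS ψ hψ K).Bit G (n * (K + 1) + j) (⟨j, hj⟩, ⟨φ, hφ⟩) v ↔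
        φ.Eval G (IteratedEval ψ G n) v) := by
    intro n hvar j
    induction j with
    | zero =>
      intro hj φ hφ v hd
      cases φ with
      | top => exact iff_of_true (bit_evalNetwork_top ..) trivial
      | symb p => exact bit_evalNetwork_symb ..
      | var x => exact hvar x hφ v
      | _ => simp [Schema.depth] at hd
    | succ j ih =>
      intro hj φ hφ v hd
      have hj' : j < K + 1 := by omega
      have hpred : (⟨j + 1, hj⟩ : Fin (K + 1)) - 1 = ⟨j, hj'⟩ := by
        rw [sub_eq_iff_eq_add, Fin.ext_iff, Fin.val_add, Fin.val_one', Nat.add_mod_mod,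
          Nat.mod_eq_of_lt hj]
      have ih := ih hj'
      rw [← add_assoc]
      cases φ with
      | top => exact iff_of_true (bit_evalNetwork_top ..) trivial
      | symb p => exact bit_evalNetwork_symb ..
      | var x =>
        have hne : (⟨j + 1, hj⟩ : Fin (K + 1)) ≠ 0 := by simp [Fin.ext_iff]
        simp only [GateNetwork.Bit]
        simp only [evalNetwork, evalGate, if_neg hne, Gate.Holds, hpred, and_self]
        exact ih _ hφ v (Nat.zero_le _)
      | neg φ =>
        simp only [Schema.depth] at hd
        simp only [GateNetwork.Bit, Schema.Eval]
        simp only [evalNetwork, evalGate, Gate.Holds, hpred]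
        exact not_congr (ih _ _ v (by omega))
      | and φ χ =>
        simp only [Schema.depth] at hd
        simp only [GateNetwork.Bit, Schema.Eval]
        simp only [evalNetwork, evalGate, Gate.Holds, hpred]
        exact and_congr (ih _ _ v (by omega)) (ih _ _ v (by omega))
      | dia k φ =>
        simp only [Schema.depth] at hd
        have := fun h u => ih φ h u (by omega)
        simp only [GateNetwork.Bit, Schema.Eval]
        simp only [evalNetwork, evalGate, Gate.Holds, hpred] at this ⊢
        simp only [this]
      | gdia hg k φ =>
        simp only [Schema.depth] at hd
        have := fun h u => ih φ h u (by omega)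
        simp only [GateNetwork.Bit, Schema.Eval]
        simp only [evalNetwork, evalGate, Gate.Holds, hpred] at this ⊢
        simp only [this]
  induction n with
  | zero =>
    refine zero 0 fun x h v => ?_
    simp only [zero_mul, GateNetwork.Bit, evalNetwork, evalInit, IteratedEval]
  | succ n ih =>
    refine zero (n + 1) fun x h v => ?_
    -- Phase `0` of the next iteration directly follows phase `K`, where all bodies are settled
    -- because their depth is at most `K`; the variable gates of phase `0` read the bodies there.
    rw [show (n + 1) * (K + 1) = n * (K + 1) + K + 1 by ring]
    simp only [GateNetwork.Bit, IteratedEval]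
    rw [← ih K (Nat.lt_succ_self K) (ψ x) (hψ x) v (hK x)]
    simp only [evalNetwork, evalGate, if_true, Gate.Holds, and_self]
    rfl

end

theorem exists_gateNetwork_iteratedEval {g : Bool} {L : Finset LAB} {X : Type} [Finite X]
    (ψ : X → Schema g L X) : ∃ (I : Type) (_ : Finite I) (W : GateNetwork g L I) (ix : X → I)
      (K : ℕ), 0 < K ∧ ∀ G n x v, W.Bit G (n * K) (ix x) v ↔ IteratedEval ψ G n x v := by
  -- The variables are added so that each has a bit to be read off, even if it occurs in no body.
  obtain ⟨S, hf, hc, h⟩ := exists_closed_of_family (Sum.elim ψ Schema.var)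
  obtain ⟨K, hK⟩ : ∃ K, ∀ x, (ψ x).depth ≤ K := by
    obtain ⟨K, hK⟩ := (Set.finite_range fun x => (ψ x).depth).bddAbove
    exact ⟨K, fun x => hK ⟨x, rfl⟩⟩
  have := hf.to_subtype
  exact ⟨Fin (K + 1) × S, inferInstance, evalNetwork hc ψ (fun x => h (.inl x)) K,
    fun x => (0, ⟨.var x, h (.inr x)⟩), K + 1, K.succ_pos, fun G n x v =>
    bit_evalNetwork hc ψ _ K hK G n 0 K.succ_pos _ (h (.inr x)) v le_rfl⟩

/-- The bodies of a program with head predicates that are false in round `0`, in which the rounds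
are delayed by one. The head predicate `none` is true from round `1` on. -/
def GMSCProgram.delayed {g : Bool} {L : Finset LAB} {𝒯 : Finset VAR} (Λ : GMSCProgram g L 𝒯) :
    Option 𝒯 → Schema g L (Option 𝒯)
  | none => .top
  | some X =>
    .and (((Schema.var none).and ((Λ.iteration X).rename some).neg).neg)
      (((Schema.var none).neg.and ((Λ.terminal X).rename Empty.elim).neg).neg)

/-- Terminal bodies may contain modalities, which the initial labeling of a node cannot evaluate.
They are evaluated in the first iteration instead: `none` is false only in round `0`, so it selects
the terminal body once and the iteration body ever after. -/
theorem GMSCProgram.iteratedEval_delayed {g : Bool} {L : Finset LAB} {𝒯 : Finset VAR}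
    (Λ : GMSCProgram g L 𝒯) (G : LGraph L) (n : ℕ) (X : 𝒯) (v : G.V) :
    IteratedEval Λ.delayed G (n + 1) (some X) v ↔ Schema.Sat G v (Λ.iter n X) := by
  induction n generalizing X v with
  | zero =>
    simp [IteratedEval, GMSCProgram.delayed, Schema.Eval, Schema.eval_rename, GMSCProgram.iter,
      Schema.sat_iff_eval G fun _ _ => False]
  | succ n ih =>
    rw [IteratedEval, GMSCProgram.iter, Schema.sat_subst]
    have h : ∀ v, IteratedEval Λ.delayed G (n + 1) none v := fun v => trivial
    have h' : (fun x => IteratedEval Λ.delayed G (n + 1) (some x)) =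
        fun x u => Schema.Sat G u (Λ.iter n x) := funext fun x => funext fun u => propext (ih x u)
    simp only [GMSCProgram.delayed, Schema.Eval, Schema.eval_rename, h, h']
    simp

theorem GMSCProgram.exists_gateNetwork {g : Bool} {L : Finset LAB} {𝒯 : Finset VAR}
    (Λ : GMSCProgram g L 𝒯) : ∃ (I : Type) (_ : Finite I) (_ : Nonempty I) (W : GateNetwork g L I)
      (ix : 𝒯 → I) (τ : ℕ → ℕ), StrictMono τ ∧
        ∀ G t X v, W.Bit G (τ t) (ix X) v ↔ Schema.Sat G v (Λ.iter t X) := by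
  obtain ⟨I, hI, W, ix, K, hK, h⟩ := exists_gateNetwork_iteratedEval Λ.delayed
  -- The `+ 1` in `τ` is the delay by one iteration. The bit of `none` keeps the network nonempty
  -- even if `𝒯` is empty, as the dimension must be positive.
  refine ⟨I, hI, ⟨ix none⟩, W, fun X => ix (some X), fun t => (t + 1) * K, ?_, ?_⟩
  · exact fun a b hab => Nat.mul_lt_mul_of_pos_right (Nat.succ_lt_succ hab) hK
  · intro G t X v
    rw [h, Λ.iteratedEval_delayed]

/-! ### Float sums only count multiplicities up to a bound -/

theorem FloatSystem.isNearest_round (F : FloatSystem) (q : ℚ) : F.IsNearest q (F.round q) :=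
  (F.existsUnique_isRounding q).choose_spec.1.1

/-- The float `x` is closer to `x + a` than any float below `x`, so rounding cannot go below `x`. -/
theorem FloatSystem.le_add_of_nonneg (F : FloatSystem) (x : F.Carrier) {a : F.Carrier}
    (ha : 0 ≤ (a : ℚ)) : x ≤ F.add x a := by
  by_contra h
  have h : ((F.add x a : F.Carrier) : ℚ) < x := not_le.1 h
  have h' := F.isNearest_round ((x : ℚ) + a) x
  change |(x : ℚ) + a - (F.add x a : F.Carrier)| ≤ _ at h'
  rw [abs_of_nonneg (by linarith), abs_of_nonneg (by linarith)] at h'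
  linarith

theorem FloatSystem.add_le_of_nonpos (F : FloatSystem) (x : F.Carrier) {a : F.Carrier}
    (ha : (a : ℚ) ≤ 0) : F.add x a ≤ x := by
  by_contra h
  have h : (x : ℚ) < (F.add x a : F.Carrier) := not_le.1 h
  have h' := F.isNearest_round ((x : ℚ) + a) x
  change |(x : ℚ) + a - (F.add x a : F.Carrier)| ≤ _ at h'
  rw [abs_of_nonpos (by linarith), abs_of_nonpos (by linarith)] at h'
  linarith

/-- Once an iterate repeats, it stays fixed. Otherwise the iterates `0, …, m` would form a strictly
increasing chain of `m + 1 > Nat.card α` elements. -/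
theorem iterate_succ_eq_of_card_le {α : Type*} [Finite α] [PartialOrder α] {f : α → α}
    (hf : ∀ x, x ≤ f x) {m : ℕ} (hm : Nat.card α ≤ m) (x : α) : f^[m + 1] x = f^[m] x := by
  by_contra hne
  have hstep : ∀ i ≤ m, f^[i + 1] x ≠ f^[i] x := by
    intro i hi h
    refine hne ?_
    obtain ⟨j, rfl⟩ := Nat.exists_eq_add_of_le' hi
    rw [add_assoc, Function.iterate_add_apply f j (i + 1), h, ← Function.iterate_add_apply]
  have hmono : StrictMono fun i : Fin (m + 1) => f^[(i : ℕ)] x := by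
    rw [Fin.strictMono_iff_lt_succ]
    intro i
    refine lt_of_le_of_ne ?_ (Ne.symm (hstep i i.2.le))
    simpa [Function.iterate_succ_apply'] using hf (f^[(i : ℕ)] x)
  have := Nat.card_le_card_of_injective _ hmono.injective
  rw [Nat.card_fin] at this
  omega

/-- Adding a fixed float is inflationary or deflationary according to its sign; the second case is
the first in the dual order. -/
theorem FloatSystem.iterate_add_eq (F : FloatSystem) (a : F.Carrier) {m : ℕ}
    (hm : Nat.card F.Carrier ≤ m) (x : F.Carrier) :
    (fun y => F.add y a)^[m + 1] x = (fun y => F.add y a)^[m] x := by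
  rcases le_total 0 (a : ℚ) with h | h
  · exact iterate_succ_eq_of_card_le (fun y => F.le_add_of_nonneg y h) hm x
  · exact iterate_succ_eq_of_card_le (α := F.Carrierᵒᵈ) (fun y => F.add_le_of_nonpos y h) hm x

theorem List.foldl_replicate_eq_iterate {α β : Type*} (f : β → α → β) (a : α) (n : ℕ) (b : β) :
    (List.replicate n a).foldl f b = (fun y => f y a)^[n] b := by
  induction n generalizing b with
  | zero => rfl
  | succ n ih => rw [List.replicate_succ, List.foldl_cons, ih, Function.iterate_succ_apply]

/-- Summation in increasing order makes the copies of `a` consecutive, so together they act as an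
iterate of adding `a`. -/
theorem Multiset.sort_eq_append {α : Type*} [LinearOrder α] (M : Multiset α) (a : α) :
    M.sort (· ≤ ·) = (M.filter (· < a)).sort (· ≤ ·) ++
      (List.replicate (M.count a) a ++ (M.filter (a < ·)).sort (· ≤ ·)) := by
  refine List.Perm.eq_of_pairwise' (r := (· ≤ ·)) (M.pairwise_sort _) ?_ ?_
  · rw [List.pairwise_append, List.pairwise_append]
    refine ⟨Multiset.pairwise_sort _ _, ⟨List.pairwise_replicate_of_refl,
      Multiset.pairwise_sort _ _, ?_⟩, ?_⟩
    · intro x hx y hy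
      rw [List.eq_of_mem_replicate hx]
      exact (Multiset.of_mem_filter ((Multiset.mem_sort _).1 hy)).le
    · intro x hx y hy
      have hx := Multiset.of_mem_filter ((Multiset.mem_sort _).1 hx)
      rcases List.mem_append.1 hy with hy | hy
      · rw [List.eq_of_mem_replicate hy]
        exact hx.le
      · exact (hx.trans (Multiset.of_mem_filter ((Multiset.mem_sort _).1 hy))).le
  · rw [← Multiset.coe_eq_coe, ← Multiset.coe_add, ← Multiset.coe_add, Multiset.sort_eq,
      Multiset.sort_eq, Multiset.sort_eq, Multiset.coe_replicate]
    ext x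
    simp only [Multiset.count_add, Multiset.count_filter, Multiset.count_replicate]
    rcases lt_trichotomy x a with h | rfl | h
    · simp [h, h.ne', h.not_gt]
    · simp
    · simp [h, h.ne, h.not_gt]

theorem FloatSystem.sum_cons (F : FloatSystem) (M : Multiset F.Carrier) (a : F.Carrier)
    (h : Nat.card F.Carrier ≤ M.count a) : F.sum (a ::ₘ M) = F.sum M := by
  unfold FloatSystem.sum FloatSystem.listSum
  rw [Multiset.sort_eq_append M a, Multiset.sort_eq_append (a ::ₘ M) a]
  simp only [List.foldl_append, List.foldl_replicate_eq_iterate, Multiset.count_cons_self,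
    lt_irrefl, not_false_eq_true, Multiset.filter_cons_of_neg]
  rw [F.iterate_add_eq a]
  convert h

theorem FloatSystem.sum_add (F : FloatSystem) (M R : Multiset F.Carrier)
    (h : ∀ a ∈ R, Nat.card F.Carrier ≤ M.count a) : F.sum (R + M) = F.sum M := by
  induction R using Multiset.induction_on with
  | empty => simp
  | cons a R ih =>
    rw [Multiset.cons_add, F.sum_cons, ih fun b hb => h b (Multiset.mem_cons_of_mem hb)]
    rw [Multiset.count_add]
    exact le_add_left (h a (Multiset.mem_cons_self a R))

theorem count_kProj_of_decidableEq {Q : Type} [DecidableEq Q] (k : ℕ) (M : Multiset Q) (x : Q) :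
    (kProj k M).count x = min (M.count x) k := by
  convert count_kProj k M x

/-- Within each block of equal floats the running sum is constant after `Nat.card F.Carrier`
additions, so this number serves as a bound in every component. -/
theorem FloatSystem.isBounded_vecSum (F : FloatSystem) (d : ℕ+) :
    IsBounded (F.vecSum : Multiset (F.Vec d) → F.Vec d) := by
  refine ⟨Nat.card F.Carrier, fun M => funext fun l => ?_⟩
  have hle : kProj (Nat.card F.Carrier) M ≤ M := by
    rw [Multiset.le_iff_count]
    intro x
    rw [count_kProj_of_decidableEq]
    exact min_le_left _ _
  unfold FloatSystem.vecSum
  -- A vector dropped by the projection still has `Nat.card F.Carrier` copies in it, hence each of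
  -- its components has at least as many copies in the projected multiset, and dropping it does not
  -- change the sum.
  conv_lhs => rw [← Multiset.sub_add_cancel hle, Multiset.map_add]
  refine F.sum_add _ _ fun a ha => ?_
  obtain ⟨x, hx, rfl⟩ := Multiset.mem_map.1 ha
  rw [← Multiset.count_pos, Multiset.count_sub, count_kProj_of_decidableEq] at hx
  have h1 : (kProj (Nat.card F.Carrier) M).count x = Nat.card F.Carrier := by
    rw [count_kProj_of_decidableEq]
    omega
  rw [Multiset.le_count_iff_replicate_le]
  have h2 := Multiset.map_le_map (f := fun y => y l) (Multiset.le_count_iff_replicate_le.1 h1.ge)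
  rwa [Multiset.map_replicate] at h2

/-! ### Integer arithmetic with floats -/

/-- The binary floating-point system with `p` digits and maximal exponent `p`. -/
def binaryFloats (p : ℕ) (hp : 1 ≤ p) : FloatSystem where
  p := p
  n := p
  β := 2
  hp := hp
  hβ := le_rfl

section
variable {p : ℕ} {hp : 1 ≤ p}

local notation "𝔽" => binaryFloats p hp

theorem binaryFloats_abs_le (x : FloatSystem.Carrier 𝔽) : |(x : ℚ)| ≤ ((2 ^ p - 1 : ℤ) : ℚ) := by
  obtain ⟨q, m, e, hm, -, he, rfl⟩ := x
  simp only [binaryFloats, Nat.cast_ofNat] at hm he ⊢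
  have h1 : (|m| : ℚ) ≤ ((2 ^ p - 1 : ℤ) : ℚ) := by exact_mod_cast Int.le_sub_one_of_lt hm
  have h2 : (2 : ℚ) ^ (e - (p : ℤ)) ≤ 1 := zpow_le_one_of_nonpos₀ (by norm_num) (by omega)
  have h3 : (0 : ℚ) < (2 : ℚ) ^ (e - (p : ℤ)) := by positivity
  rw [abs_mul, abs_of_pos h3]
  exact (mul_le_of_le_one_right (abs_nonneg _) h2).trans h1

/-- At exponent `p` the scaling factor `2 ^ (e - p)` is `1`, whence the choice of the exponent
bound. As no float is larger in magnitude, `2 ^ p - 1` is the largest float. -/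
theorem binaryFloats_exists (m : ℤ) (hm : |m| ≤ 2 ^ p - 1) :
    ∃ x : FloatSystem.Carrier 𝔽, (x : ℚ) = m := by
  refine ⟨⟨m, m, p, ?_, ?_, le_rfl, ?_⟩, rfl⟩
  · simp only [binaryFloats, Nat.cast_ofNat]
    omega
  · simp only [binaryFloats]
    omega
  · simp [binaryFloats]

theorem binaryFloats_round (m : ℤ) (hm : |m| ≤ 2 ^ p - 1) :
    (FloatSystem.round 𝔽 m : ℚ) = m := by
  obtain ⟨x, hx⟩ := binaryFloats_exists (hp := hp) m hm
  have h := FloatSystem.isNearest_round 𝔽 m x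
  rw [hx, sub_self, abs_zero] at h
  have := abs_nonpos_iff.1 h
  linarith

/-- Overflow saturates: the largest float is closest to everything above it. -/
theorem binaryFloats_round_of_le (m : ℤ) (hm : 2 ^ p - 1 ≤ m) :
    (FloatSystem.round 𝔽 m : ℚ) = ((2 ^ p - 1 : ℤ) : ℚ) := by
  have hpos : (0 : ℤ) ≤ 2 ^ p - 1 := by
    have := one_le_pow₀ (n := p) (show (1 : ℤ) ≤ 2 by norm_num)
    omega
  obtain ⟨x, hx⟩ := binaryFloats_exists (hp := hp) (2 ^ p - 1) (abs_of_nonneg hpos).le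
  have h := FloatSystem.isNearest_round 𝔽 m x
  have hle := (abs_le.1 (binaryFloats_abs_le (FloatSystem.round 𝔽 m))).2
  have hm' : ((2 ^ p - 1 : ℤ) : ℚ) ≤ m := by exact_mod_cast hm
  rw [hx, abs_of_nonneg (by linarith), abs_of_nonneg (by linarith)] at h
  linarith

theorem binaryFloats_add {x y : FloatSystem.Carrier 𝔽} {a b : ℤ} (hx : (x : ℚ) = a)
    (hy : (y : ℚ) = b) (h : |a + b| ≤ 2 ^ p - 1) :
    (FloatSystem.add 𝔽 x y : ℚ) = ((a + b : ℤ) : ℚ) := by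
  rw [FloatSystem.add, hx, hy, ← Int.cast_add, binaryFloats_round _ h]

theorem binaryFloats_mul {x y : FloatSystem.Carrier 𝔽} {a b : ℤ} (hx : (x : ℚ) = a)
    (hy : (y : ℚ) = b) (h : |a * b| ≤ 2 ^ p - 1) :
    (FloatSystem.mul 𝔽 x y : ℚ) = ((a * b : ℤ) : ℚ) := by
  rw [FloatSystem.mul, hx, hy, ← Int.cast_mul, binaryFloats_round _ h]

/-- Bounding the sum of the absolute values keeps every partial sum in the exact range, whatever
cancellations occur. -/
theorem binaryFloats_foldl {ι : Type*} (f : ι → FloatSystem.Carrier 𝔽) (z : ι → ℤ)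
    (hf : ∀ i, (f i : ℚ) = z i) (l : List ι) : ∀ (x : FloatSystem.Carrier 𝔽) (a : ℤ),
      (x : ℚ) = a → |a| + (l.map fun i => |z i|).sum ≤ 2 ^ p - 1 →
      (((l.map f).foldl (FloatSystem.add 𝔽) x : FloatSystem.Carrier 𝔽) : ℚ) =
        ((a + (l.map z).sum : ℤ) : ℚ) := by
  induction l with
  | nil => intro x a hx _; simpa using hx
  | cons i l ih =>
    intro x a hx h
    simp only [List.map_cons, List.sum_cons, List.foldl_cons] at h ⊢
    have h0 : 0 ≤ (l.map fun i => |z i|).sum := List.sum_nonneg (by simp)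
    have h1 := abs_add_le a (z i)
    rw [ih _ _ (binaryFloats_add hx (hf i) (by omega)) (by omega), add_assoc]

theorem binaryFloats_vecMul {d : ℕ+} {x : FloatSystem.Vec 𝔽 d}
    {C : Matrix (Fin d) (Fin d) (FloatSystem.Carrier 𝔽)} {I : Type} [Fintype I] (e : I ≃ Fin d)
    {a w : I → ℤ} (l : Fin d) (hx : ∀ k, (x k : ℚ) = a (e.symm k))
    (hC : ∀ k, (C k l : ℚ) = w (e.symm k)) (h : ∑ i, |a i * w i| ≤ 2 ^ p - 1) :
    (FloatSystem.vecMul 𝔽 x C l : ℚ) = ((∑ i, a i * w i : ℤ) : ℚ) := by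
  have hmul : ∀ k, (FloatSystem.mul 𝔽 (x k) (C k l) : ℚ) =
      ((a (e.symm k) * w (e.symm k) : ℤ) : ℚ) := fun k =>
    binaryFloats_mul (hx k) (hC k)
      ((Finset.single_le_sum (f := fun i => |a i * w i|) (fun i _ => abs_nonneg _)
        (Finset.mem_univ (e.symm k))).trans h)
  rw [← Equiv.sum_comp e.symm, ← List.sum_ofFn, List.ofFn_eq_map] at h
  have := binaryFloats_foldl _ _ hmul (List.finRange d) 0 0 rfl (by rwa [abs_zero, zero_add])
  rw [FloatSystem.vecMul, FloatSystem.listSum, List.ofFn_eq_map, this, ← Equiv.sum_comp e.symm,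
    ← List.sum_ofFn, List.ofFn_eq_map, zero_add]

/-- On integers the truncated ReLU is a threshold test, which is what lets it compute bits. -/
theorem binaryFloats_reluStar {x : FloatSystem.Carrier 𝔽} {a : ℤ} (hx : (x : ℚ) = a) :
    (FloatSystem.reluStar 𝔽 x : ℚ) = if 1 ≤ a then 1 else 0 := by
  have h1 : (1 : ℤ) ≤ 2 ^ p - 1 := by
    have := pow_le_pow_right₀ (show (1 : ℤ) ≤ 2 by norm_num) hp
    omega
  have h2 : min (max 0 (x : ℚ)) 1 = ((if 1 ≤ a then 1 else 0 : ℤ) : ℚ) := by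
    rw [hx]
    split_ifs with h
    · have : (1 : ℚ) ≤ a := by exact_mod_cast h
      simp [this]
    · have : (a : ℚ) ≤ 0 := by exact_mod_cast (by omega : a ≤ 0)
      simp [this]
  rw [FloatSystem.reluStar, h2, binaryFloats_round]
  · split_ifs <;> simp
  · split_ifs <;> simp <;> omega

/-- A running sum of bits counts exactly up to `2 ^ p - 1` and then stays there, since a further `1`
is rounded away. -/
theorem binaryFloats_foldl_bits (l : List (FloatSystem.Carrier 𝔽))
    (hl : ∀ y ∈ l, (y : ℚ) = if (y : ℚ) = 1 then 1 else 0) :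
    ∀ (x : FloatSystem.Carrier 𝔽) (c : ℕ), (x : ℚ) = ((min c (2 ^ p - 1) : ℤ) : ℚ) →
      ((l.foldl (FloatSystem.add 𝔽) x : FloatSystem.Carrier 𝔽) : ℚ) =
        ((min ((c + l.countP fun y : FloatSystem.Carrier 𝔽 => (y : ℚ) = 1 : ℕ) : ℤ)
          (2 ^ p - 1) : ℤ) : ℚ) := by
  induction l with
  | nil => intro x c hx; simpa using hx
  | cons y l ih =>
    intro x c hx
    have hp' : (0 : ℤ) ≤ 2 ^ p - 1 := by
      have := one_le_pow₀ (n := p) (show (1 : ℤ) ≤ 2 by norm_num)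
      omega
    have h1 : (FloatSystem.add 𝔽 x y : ℚ) =
        ((min ((c + if (y : ℚ) = 1 then 1 else 0 : ℕ) : ℤ) (2 ^ p - 1) : ℤ) : ℚ) := by
      have hy : (y : ℚ) = (((if (y : ℚ) = 1 then 1 else 0 : ℕ) : ℤ) : ℚ) :=
        (hl y List.mem_cons_self).trans (by split_ifs <;> simp)
      generalize (if (y : ℚ) = 1 then 1 else 0 : ℕ) = b at hy ⊢
      rw [FloatSystem.add, hx, hy, ← Int.cast_add]
      rcases le_or_gt (min (c : ℤ) (2 ^ p - 1) + b) (2 ^ p - 1) with h | h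
      · rw [binaryFloats_round _ (abs_le.2 ⟨by omega, h⟩)]
        congr 1
        omega
      · rw [binaryFloats_round_of_le _ h.le]
        congr 1
        omega
    rw [List.foldl_cons, ih (fun z hz => hl z (List.mem_cons_of_mem _ hz)) _ _ h1,
      List.countP_cons, add_assoc, add_comm (List.countP _ _)]
    simp only [decide_eq_true_eq]

open Classical in
/-- Sums of bits are exact up to the largest float. -/
theorem binaryFloats_vecSum_bits {d : ℕ+} {V : Type} {s : Set V} (hs : s.Finite)
    (x : V → FloatSystem.Vec 𝔽 d) (k : Fin d) (P : V → Prop)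
    (hx : ∀ u, (x u k : ℚ) = if P u then 1 else 0) :
    (FloatSystem.vecSum 𝔽 (hs.toFinset.val.map x) k : ℚ) =
      ((min ({u | u ∈ s ∧ P u}.ncard : ℤ) (2 ^ p - 1) : ℤ) : ℚ) := by
  have hp' : (0 : ℤ) ≤ 2 ^ p - 1 := by
    have := one_le_pow₀ (n := p) (show (1 : ℤ) ≤ 2 by norm_num)
    omega
  rw [FloatSystem.vecSum, FloatSystem.sum, FloatSystem.listSum, Multiset.map_map]
  have hbit : ∀ y ∈ (hs.toFinset.val.map ((fun y : FloatSystem.Vec 𝔽 d => y k) ∘ x)).sort (· ≤ ·),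
      ((y : FloatSystem.Carrier 𝔽) : ℚ) = if (y : ℚ) = 1 then 1 else 0 := by
    intro y hy
    rw [Multiset.mem_sort, Multiset.mem_map] at hy
    obtain ⟨u, -, rfl⟩ := hy
    rw [Function.comp, hx]
    split_ifs <;> simp_all
  rw [binaryFloats_foldl_bits _ hbit 0 0 (by rw [Nat.cast_zero, min_eq_left hp']; rfl), zero_add,
    ← Multiset.coe_countP, Multiset.sort_eq, Multiset.countP_map]
  have hset : {u | u ∈ s ∧ P u} =
      (hs.toFinset.filter fun u => ((x u k : FloatSystem.Carrier 𝔽) : ℚ) = 1 : Finset V) := by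
    ext u
    simp [hx]
  rw [hset, Set.ncard_coe_finset]
  rfl

end

/-! ### Gate networks as R-simple GNNs -/

open Classical in
/-- The weights of the bits of the node itself. -/
noncomputable def Gate.selfWeight {g : Bool} {I : Type} : Gate g I → I → ℤ
  | not i, l => if l = i then -1 else 0
  | and i j, l => (if l = i then 1 else 0) + if l = j then 1 else 0
  | _, _ => 0

open Classical in
/-- The weights of the sums of the bits of the out-neighbours. -/
noncomputable def Gate.outWeight {g : Bool} {I : Type} : Gate g I → I → ℤ
  -- For `k = 0` the bias `1` alone makes the gate true. Weight `1` could lift a saturated count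
  -- beyond the largest float and leave the range of exact arithmetic.
  | dia k i, l => if l = i then (if k = 0 then 0 else 1) else 0
  | _, _ => 0

open Classical in
/-- The weights of the sums of the bits of all nodes. -/
noncomputable def Gate.allWeight {g : Bool} {I : Type} : Gate g I → I → ℤ
  | gdia _ k i, l => if l = i then (if k = 0 then 0 else 1) else 0
  | _, _ => 0

/-- The bias of a gate. -/
def Gate.bias {g : Bool} {I : Type} : Gate g I → ℤ
  | one => 1
  | not _ => 1
  | and _ _ => -1
  | dia k _ => 1 - k
  | gdia _ k _ => 1 - k

theorem Gate.allWeight_eq_zero {I : Type} (γ : Gate false I) (l : I) : γ.allWeight l = 0 := by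
  cases γ with
  | gdia h => simp at h
  | _ => rfl

/-- The value `2` arises when both inputs of an `and` are the same bit, as in the gates that copy a
bit. -/
theorem Gate.abs_weight_le {g : Bool} {I : Type} (γ : Gate g I) (l : I) :
    |γ.selfWeight l| ≤ 2 ∧ |γ.outWeight l| ≤ 2 ∧ |γ.allWeight l| ≤ 2 := by
  cases γ <;> simp only [Gate.selfWeight, Gate.outWeight, Gate.allWeight] <;>
    refine ⟨?_, ?_, ?_⟩ <;> (try split_ifs) <;> norm_num

/-- The linear forms are `1 - x`, `x + x' - 1` and `y + 1 - k`, each at least `1` precisely when the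
gate holds. Truncating counts at `M` is harmless: `|1 - k| < M` forces `k ≤ M`. The other bounds
follow the order of operations in `COM`, so that every intermediate float result is exact. -/
theorem Gate.holds_iff {g : Bool} {L : Finset LAB} {I : Type} [Fintype I] (γ : Gate g I) {M : ℤ}
    (hM : 2 ≤ M) (hγ : |γ.bias| < M) (G : LGraph L) (b : I → G.V → Prop) (v : G.V) (x y z : I → ℤ)
    (hx : ∀ i, (b i v → x i = 1) ∧ (¬ b i v → x i = 0))
    (hy : ∀ i, y i = min ({u | G.E v u ∧ b i u}.ncard : ℤ) M)
    (hz : ∀ i, z i = min ({u | b i u}.ncard : ℤ) M) :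
    ∑ i, |x i * γ.selfWeight i| ≤ M ∧ ∑ i, |y i * γ.outWeight i| ≤ M ∧
      ∑ i, |z i * γ.allWeight i| ≤ M ∧
      |∑ i, x i * γ.selfWeight i + ∑ i, y i * γ.outWeight i| ≤ M ∧
      |∑ i, x i * γ.selfWeight i + ∑ i, y i * γ.outWeight i + ∑ i, z i * γ.allWeight i| ≤ M ∧
      |∑ i, x i * γ.selfWeight i + ∑ i, y i * γ.outWeight i + ∑ i, z i * γ.allWeight i
        + γ.bias| ≤ M ∧
      (1 ≤ ∑ i, x i * γ.selfWeight i + ∑ i, y i * γ.outWeight i + ∑ i, z i * γ.allWeight i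
        + γ.bias ↔ γ.Holds G b v) := by
  classical
  have hx' : ∀ i, 0 ≤ x i ∧ x i ≤ 1 := fun i => by
    by_cases h : b i v
    · have := (hx i).1 h; omega
    · have := (hx i).2 h; omega
  have hone : ∀ i, 1 ≤ x i ↔ b i v := fun i => by
    by_cases h : b i v
    · have := (hx i).1 h; simp only [h, iff_true]; omega
    · have := (hx i).2 h; simp only [h, iff_false]; omega
  cases γ with
  | one =>
    simp only [Gate.selfWeight, Gate.outWeight, Gate.allWeight, Gate.bias, Gate.Holds, mul_zero,
      abs_zero, Finset.sum_const_zero]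
    norm_num
    omega
  | not i =>
    have h1 := hone i
    have h2 := hx' i
    simp only [Gate.selfWeight, Gate.outWeight, Gate.allWeight, Gate.bias, Gate.Holds, mul_zero,
      abs_zero, Finset.sum_const_zero, mul_ite, apply_ite abs, Finset.sum_ite_eq', Finset.mem_univ,
      if_true, abs_le, ← h1]
    omega
  | and i j =>
    have h1 := hone i
    have h2 := hx' i
    have h3 := hone j
    have h4 := hx' j
    have habs : ∀ l, |x l * Gate.selfWeight (Gate.and i j : Gate g I) l| =
        x l * Gate.selfWeight (Gate.and i j : Gate g I) l := fun l =>
      abs_of_nonneg (mul_nonneg (hx' l).1 (by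
        simp only [Gate.selfWeight]; split_ifs <;> simp))
    simp only [habs]
    simp only [Gate.selfWeight, Gate.outWeight, Gate.allWeight, Gate.bias, Gate.Holds, mul_zero,
      abs_zero, Finset.sum_const_zero, mul_add, Finset.sum_add_distrib, mul_ite, mul_one,
      Finset.sum_ite_eq', Finset.mem_univ, if_true, abs_le, ← h1, ← h3]
    omega
  | dia k i =>
    have h1 := hy i
    have h2 : |y i| = y i := abs_of_nonneg (by omega)
    simp only [Gate.selfWeight, Gate.outWeight, Gate.allWeight, Gate.bias, Gate.Holds, mul_zero,
      abs_zero, Finset.sum_const_zero, mul_ite, apply_ite abs, Finset.sum_ite_eq', Finset.mem_univ,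
      if_true, abs_le, abs_lt, mul_one] at hγ ⊢
    split_ifs <;> omega
  | gdia hg k i =>
    have h1 := hz i
    have h2 : |z i| = z i := abs_of_nonneg (by omega)
    simp only [Gate.selfWeight, Gate.outWeight, Gate.allWeight, Gate.bias, Gate.Holds, mul_zero,
      abs_zero, Finset.sum_const_zero, mul_ite, apply_ite abs, Finset.sum_ite_eq', Finset.mem_univ,
      if_true, abs_le, abs_lt, mul_one] at hγ ⊢
    split_ifs <;> omega

section
variable {p : ℕ} (hp : 1 ≤ p) {d : ℕ+} {g : Bool} {L : Finset LAB} {I : Type}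

local notation "𝔽" => binaryFloats p hp

/-- The matrix with the given integer weights. -/
noncomputable def weightMatrix (e : I ≃ Fin d) (w : I → I → ℤ) :
    Matrix (Fin d) (Fin d) (FloatSystem.Carrier 𝔽) :=
  fun k l => FloatSystem.round 𝔽 (w (e.symm l) (e.symm k))

/-- The biases of the gates. -/
noncomputable def GateNetwork.biasVec (W : GateNetwork g L I) (e : I ≃ Fin d) :
    FloatSystem.Vec 𝔽 d :=
  fun l => FloatSystem.round 𝔽 (W.gate (e.symm l)).bias

open Classical in
/-- The initial bits as a feature vector. -/
noncomputable def GateNetwork.initVec (W : GateNetwork g L I) (e : I ≃ Fin d)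
    (P : Set L) : FloatSystem.Vec 𝔽 d :=
  fun l => FloatSystem.round 𝔽 ((if W.init (e.symm l) P then 1 else 0 : ℤ) : ℚ)

/-- The R-simple GNN[F] with global readout that computes a network. -/
noncomputable def GateNetwork.toGNNFG (W : GateNetwork g L I) (e : I ≃ Fin d) :
    GNNFG L 𝔽 d where
  init := W.initVec hp e
  agg := FloatSystem.vecSum 𝔽
  read := FloatSystem.vecSum 𝔽
  com x y z l := FloatSystem.reluStar 𝔽 (FloatSystem.vecAdd 𝔽 (FloatSystem.vecAdd 𝔽
    (FloatSystem.vecAdd 𝔽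
      (FloatSystem.vecMul 𝔽 x (weightMatrix hp e fun i => (W.gate i).selfWeight))
      (FloatSystem.vecMul 𝔽 y (weightMatrix hp e fun i => (W.gate i).outWeight)))
      (FloatSystem.vecMul 𝔽 z (weightMatrix hp e fun i => (W.gate i).allWeight)))
    (W.biasVec hp e) l)
  bounded := FloatSystem.isBounded_vecSum 𝔽 d
  bounded_read := FloatSystem.isBounded_vecSum 𝔽 d

/-- The R-simple GNN[F] that computes a network without global gates. -/
noncomputable def GateNetwork.toGNNF (W : GateNetwork g L I) (e : I ≃ Fin d) :
    GNNF L 𝔽 d where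
  init := W.initVec hp e
  agg := FloatSystem.vecSum 𝔽
  com x y l := FloatSystem.reluStar 𝔽 (FloatSystem.vecAdd 𝔽
    (FloatSystem.vecAdd 𝔽
      (FloatSystem.vecMul 𝔽 x (weightMatrix hp e fun i => (W.gate i).selfWeight))
      (FloatSystem.vecMul 𝔽 y (weightMatrix hp e fun i => (W.gate i).outWeight)))
    (W.biasVec hp e) l)
  bounded := FloatSystem.isBounded_vecSum 𝔽 d

theorem GateNetwork.isRSimple_toGNNFG (W : GateNetwork g L I) (e : I ≃ Fin d) :
    (W.toGNNFG hp e).IsRSimple :=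
  ⟨rfl, rfl, _, _, _, _, fun _ _ _ _ => rfl⟩

theorem GateNetwork.isRSimple_toGNNF (W : GateNetwork g L I) (e : I ≃ Fin d) :
    (W.toGNNF hp e).IsRSimple :=
  ⟨rfl, _, _, _, fun _ _ _ => rfl⟩

theorem weightMatrix_apply (e : I ≃ Fin d) (w : I → I → ℤ) (h : ∀ i j, |w i j| ≤ 2 ^ p - 1)
    (k l : Fin d) : (weightMatrix hp e w k l : ℚ) = w (e.symm l) (e.symm k) :=
  binaryFloats_round _ (h _ _)

open Classical in
theorem GateNetwork.initVec_apply (W : GateNetwork g L I) (e : I ≃ Fin d) (P : Set L)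
    (l : Fin d) : (W.initVec hp e P l : ℚ) = if W.init (e.symm l) P then 1 else 0 := by
  have h1 : (1 : ℤ) ≤ 2 ^ p - 1 := by
    have := pow_le_pow_right₀ (show (1 : ℤ) ≤ 2 by norm_num) hp
    omega
  rw [GateNetwork.initVec, binaryFloats_round]
  · split_ifs <;> simp
  · split_ifs <;> simp <;> omega

/-- The largest float exceeds all constants of the network. -/
def GateNetwork.Fits (W : GateNetwork g L I) (p : ℕ) : Prop :=
  (2 : ℤ) ≤ 2 ^ p - 1 ∧ ∀ i, |(W.gate i).bias| < 2 ^ p - 1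

theorem GateNetwork.exists_fits [Finite I] (W : GateNetwork g L I) :
    ∃ p, ∃ _ : 1 ≤ p, W.Fits p := by
  -- From `2 ^ p > p` with `p = K.toNat + 2` the largest float is at least `K.toNat + 2`, above both
  -- `2` and every bias.
  obtain ⟨K, hK⟩ := (Set.finite_range fun i => |(W.gate i).bias|).bddAbove
  have h1 : (K.toNat + 2 : ℤ) < 2 ^ (K.toNat + 2) := by exact_mod_cast Nat.lt_two_pow_self
  refine ⟨K.toNat + 2, by omega, by omega, fun i => ?_⟩
  have : |(W.gate i).bias| ≤ K := hK ⟨i, rfl⟩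
  omega

open Classical in
-- If all states are bits, the aggregated values are truncated counts and `Gate.holds_iff` keeps all
-- further intermediate values in the exact range; the final threshold returns bits again, one gate
-- per component.
theorem GateNetwork.state_toGNNFG [Fintype I] (W : GateNetwork g L I) (hW : W.Fits p)
    (e : I ≃ Fin d) (G : LGraph L) (t : ℕ) : ∀ (v : G.V) (l : Fin d),
      ((W.toGNNFG hp e).state G t v l : ℚ) = if W.Bit G t (e.symm l) v then 1 else 0 := by
  induction t with
  | zero => exact fun v l => W.initVec_apply hp e _ l
  | succ t ih =>
    intro v l
    have hw := fun i j => (W.gate i).abs_weight_le j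
    obtain ⟨h1, h2, h3, h4, h5, h6, h7⟩ := (W.gate (e.symm l)).holds_iff hW.1 (hW.2 _) G (W.Bit G t)
      v (fun i => if W.Bit G t i v then 1 else 0) _ _ (fun i => by constructor <;> simp_all)
      (fun _ => rfl) (fun _ => rfl)
    have hx := binaryFloats_vecMul (hp := hp) (x := (W.toGNNFG hp e).state G t v) e l
      (fun k => by rw [ih]; split_ifs <;> simp)
      (fun k => weightMatrix_apply hp e _ (fun i j => (hw i j).1.trans hW.1) k l) h1
    have hy := binaryFloats_vecMul (hp := hp) e l
      (fun k => binaryFloats_vecSum_bits (Set.toFinite {u | G.E v u}) ((W.toGNNFG hp e).state G t) k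
        (W.Bit G t (e.symm k)) fun u => ih u k)
      (fun k => weightMatrix_apply hp e _ (fun i j => (hw i j).2.1.trans hW.1) k l) h2
    have hz := binaryFloats_vecMul (hp := hp)
      (x := FloatSystem.vecSum _ (G.allMultiset ((W.toGNNFG hp e).state G t))) e l
      (fun k => by
        rw [LGraph.allMultiset,
          binaryFloats_vecSum_bits _ _ k (W.Bit G t (e.symm k)) fun u => ih u k]
        simp only [Set.mem_univ, true_and])
      (fun k => weightMatrix_apply hp e _ (fun i j => (hw i j).2.2.trans hW.1) k l) h3
    refine (binaryFloats_reluStar (binaryFloats_add (binaryFloats_add (binaryFloats_add hx hy h4)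
      hz h5) (binaryFloats_round _ (hW.2 _).le) h6)).trans ?_
    simp only [h7]
    rfl

open Classical in
theorem GateNetwork.state_toGNNF [Fintype I] (W : GateNetwork false L I) (hW : W.Fits p)
    (e : I ≃ Fin d) (G : LGraph L) (t : ℕ) : ∀ (v : G.V) (l : Fin d),
      ((W.toGNNF hp e).state G t v l : ℚ) = if W.Bit G t (e.symm l) v then 1 else 0 := by
  induction t with
  | zero => exact fun v l => W.initVec_apply hp e _ l
  | succ t ih =>
    intro v l
    have hw := fun i j => (W.gate i).abs_weight_le j
    obtain ⟨h1, h2, h3, h4, h5, h6, h7⟩ := (W.gate (e.symm l)).holds_iff hW.1 (hW.2 _) G (W.Bit G t)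
      v (fun i => if W.Bit G t i v then 1 else 0) _ _ (fun i => by constructor <;> simp_all)
      (fun _ => rfl) (fun _ => rfl)
    -- Without global gates the readout term vanishes, so the bounds already fit the shorter sum in
    -- `COM`.
    simp only [Gate.allWeight_eq_zero, mul_zero, Finset.sum_const_zero, add_zero] at h6 h7
    have hx := binaryFloats_vecMul (hp := hp) (x := (W.toGNNF hp e).state G t v) e l
      (fun k => by rw [ih]; split_ifs <;> simp)
      (fun k => weightMatrix_apply hp e _ (fun i j => (hw i j).1.trans hW.1) k l) h1
    have hy := binaryFloats_vecMul (hp := hp) e l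
      (fun k => binaryFloats_vecSum_bits (Set.toFinite {u | G.E v u}) ((W.toGNNF hp e).state G t) k
        (W.Bit G t (e.symm k)) fun u => ih u k)
      (fun k => weightMatrix_apply hp e _ (fun i j => (hw i j).2.1.trans hW.1) k l) h2
    refine (binaryFloats_reluStar (binaryFloats_add (binaryFloats_add hx hy h4)
      (binaryFloats_round _ (hW.2 _).le) h6)).trans ?_
    simp only [h7]
    rfl

end

/-- If the bits of a GNN[F] are those of a network that evaluates a program, then the GNN[F]
simulates the program. -/
theorem GMSCProgram.trace_simulatedBy {g : Bool} {L : Finset LAB} {𝒯 : Finset VAR}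
    (Λ : GMSCProgram g L 𝒯) {I : Type} (W : GateNetwork g L I) (ix : 𝒯 → I) {τ : ℕ → ℕ}
    (hτ : StrictMono τ) (h : ∀ G t X v, W.Bit G (τ t) (ix X) v ↔ Schema.Sat G v (Λ.iter t X))
    {F : FloatSystem} {d : ℕ+} (e : I ≃ Fin d) (Y : Trace L (F.Vec d))
    (hY : ∀ G t v l, (Y G t v l : ℚ) = 1 ↔ W.Bit G t (e.symm l) v) : Λ.trace.SimulatedBy Y := by
  refine ⟨fun x => {X | (x (e (ix X)) : ℚ) = 1}, τ, hτ, fun G t v => ?_⟩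
  ext X
  simp only [Set.mem_ofPred_eq, hY, Equiv.symm_apply_apply, h, GMSCProgram.trace]

theorem exists_equiv_fin_pnat (I : Type) [Finite I] [Nonempty I] : ∃ d : ℕ+, Nonempty (I ≃ Fin d) :=
  ⟨⟨Nat.card I, Nat.card_pos⟩, ⟨Finite.equivFin I⟩⟩

theorem gmscTraces_simulatedBy_rSimpleGNNFGTraces (L : Finset LAB) :
    TracesSimulatedBy (gmscTraces true L) (rSimpleGNNFGTraces L) := by
  classical
  rintro 𝒯 _ ⟨Λ, rfl⟩
  obtain ⟨I, _, _, W, ix, τ, hτ, h⟩ := Λ.exists_gateNetwork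
  obtain ⟨p, hp, hW⟩ := W.exists_fits
  obtain ⟨d, ⟨e⟩⟩ := exists_equiv_fin_pnat I
  have := Fintype.ofFinite I
  refine ⟨(binaryFloats p hp, d), _, ⟨W.toGNNFG hp e, W.isRSimple_toGNNFG hp e, rfl⟩,
    Λ.trace_simulatedBy W ix hτ h e _ fun G t v l => ?_⟩
  rw [W.state_toGNNFG hp hW]
  simp

theorem gmscTraces_simulatedBy_rSimpleGNNFTraces (L : Finset LAB) :
    TracesSimulatedBy (gmscTraces false L) (rSimpleGNNFTraces L) := by
  classical
  rintro 𝒯 _ ⟨Λ, rfl⟩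
  obtain ⟨I, _, _, W, ix, τ, hτ, h⟩ := Λ.exists_gateNetwork
  obtain ⟨p, hp, hW⟩ := W.exists_fits
  obtain ⟨d, ⟨e⟩⟩ := exists_equiv_fin_pnat I
  have := Fintype.ofFinite I
  refine ⟨(binaryFloats p hp, d), _, ⟨W.toGNNF hp e, W.isRSimple_toGNNF hp e, rfl⟩,
    Λ.trace_simulatedBy W ix hτ h e _ fun G t v l => ?_⟩
  rw [W.state_toGNNF hp hW]
  simp

end RecGNN

theorem mainTheorem10 {B B' T : Type*} (L : Finset RecGNN.LAB)
    (σ : RecGNN.ColorSimilarity B B') :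
    (RecGNN.SameExpressivePowerWrt T σ (RecGNN.GNNAG L B) (RecGNN.RSimpleGNNAG L B') ∧
      RecGNN.SameExpressivePowerWrt T σ (RecGNN.GNNAG L B) (RecGNN.GMSC true L B') ∧
      RecGNN.SameExpressivePowerWrt T σ (RecGNN.RSimpleGNNAG L B) (RecGNN.GMSC true L B')) ∧
    (RecGNN.SameExpressivePowerWrt T σ (RecGNN.GNNA L B) (RecGNN.RSimpleGNNA L B') ∧
      RecGNN.SameExpressivePowerWrt T σ (RecGNN.GNNA L B) (RecGNN.GMSC false L B') ∧
      RecGNN.SameExpressivePowerWrt T σ (RecGNN.RSimpleGNNA L B) (RecGNN.GMSC false L B')) :=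
  ⟨RecGNN.sameExpressivePowerWrt_of_cycle σ (RecGNN.hasTraces_GNNAG L B)
      (RecGNN.hasTraces_RSimpleGNNAG L B) (RecGNN.hasTraces_RSimpleGNNAG L B')
      (RecGNN.hasTraces_GMSC true L B') (RecGNN.rSimpleGNNFGTraces_simulatedBy_gnnfgTraces L)
      (RecGNN.rSimpleGNNFGTraces_simulatedBy_gnnfgTraces L)
      (RecGNN.gnnfgTraces_simulatedBy_gmscTraces L)
      (RecGNN.gmscTraces_simulatedBy_rSimpleGNNFGTraces L)
      (RecGNN.gmscTraces_simulatedBy_rSimpleGNNFGTraces L),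
    RecGNN.sameExpressivePowerWrt_of_cycle σ (RecGNN.hasTraces_GNNA L B)
      (RecGNN.hasTraces_RSimpleGNNA L B) (RecGNN.hasTraces_RSimpleGNNA L B')
      (RecGNN.hasTraces_GMSC false L B') (RecGNN.rSimpleGNNFTraces_simulatedBy_gnnfTraces L)
      (RecGNN.rSimpleGNNFTraces_simulatedBy_gnnfTraces L)
      (RecGNN.gnnfTraces_simulatedBy_gmscTraces L)
      (RecGNN.gmscTraces_simulatedBy_rSimpleGNNFTraces L)
      (RecGNN.gmscTraces_simulatedBy_rSimpleGNNFTraces L)⟩
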